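/- **Setting.** Let $F$ be a probability distribution on $[0,1]$ with a density $f$ that is continuous on $(0,1)$ and with a cumulative distribution function $F(\cdot)$ that is strictly increasing on $[0,1]$; let $I:[0,1]\to[0,1]$ be the inverse of $F(\cdot)$. Workers $x_1$, coworkers $x_2$ and firms $z$ are all distributed according to $F$, and a triple produces $y(x_1,x_2,z)=z(1-x_1x_2)$. An *assignment* is a probability measure $\pi$ on $[0,1]^3$ all three of whose marginals are $F$; it is *optimal* if it maximizes $\int y\,d\pi$. A *dual solution* is a pair $(w,v)$ of functions (wages and firm values), integrable with respect to $F$, that minimizes $2\int w\,dF+\int v\,dF$ among all such pairs that satisfy $$w(x_1)+w(x_2)+v(z)\ \ge\ y(x_1,x_2,z)\qquad\text{for all }(x_1,x_2,z)\in[0,1]^3 .$$ For $p\in(0,\tfrac13)$ put $\mathcal C(p)=\exp\Big(\frac{1}{\frac13-p}\int_{p}^{1-2p}\log I(s)\,ds\Big)$. Let $\underline p\in(0,\tfrac13)$ be a solution of $\mathcal C(\underline p)=I(1-2\underline p)^2\,I(\underline p)$; if this equation has no solution in $(0,\tfrac13)$, let $\underline p=\tfrac13$. Put $\bar p=1-2\underline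 p$ and, if $\underline p<\tfrac13$, $\mathcal C=\mathcal C(\underline p)$. Assume that (a) $x f(x)$ is nondecreasing on $[I(\underline p),I(\bar p)]$; (b) $L(p)=2\log I(1-2p)+\log I(p)$ is concave on $(0,\tfrac13]$. For $x\in[0,1]$ and $p=F(x)$ define $$m(x)=\begin{cases}-I(1-2p)^2 & p\in[0,\underline p],\\ -\mathcal C/I(p) & p\in(\underline p,\bar p),\\ -I(p)\,I\!\left(\tfrac{1-p}{2}\right) & p\in[\bar p,1]\ \text{and}\ p>\underline p.\end{cases}$$ **Proposition (Marginal Wages and Firm Values).** 1. There is a dual solution $(w,v)$ with $w$ and $v$ continuous on $[0,1]$, and every dual solution coincides $F$-almost everywhere with a dual solution that is continuous on $[0,1]$. 2. If $(w,v)$ is a dual solution with $w$ and $v$ continuous on $[0,1]$, then $w$ and $v$ are continuously differentiable on $[0,1]$ (with one-sided derivatives at the end points), and $$w'(x)=m(x),\qquad v'(z)=m(z)+1\qquad\text{for all }x,z\in[0,1].$$ 3. Here $m$ is the marginal product: an optimal assignment exists, and under every optimal assignment $\pi$, for $\pi$-almost every $(x_1,x_2,z)$, $m(x_1)=-x_2z$,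 $m(x_2)=-x_1z$ and $m(z)=-x_1x_2$. -/

import Mathlib

open Set MeasureTheory ProbabilityTheory

noncomputable section

namespace TeamSorting

/-- Expected output of the firm `z` with the workers `x₁`, `x₂` (failure probabilities). -/
def output (x₁ x₂ z : ℝ) : ℝ := z * (1 - x₁ * x₂)

/-- A distribution of types on `[0,1]`: the probability measure `F` has a density `f` that is
continuous on the open unit interval (possibly unbounded at its ends), and its cumulative
distribution function is strictly increasing on `[0,1]`. -/
structure IsTypeDistribution (F : Measure ℝ) (f : ℝ → ℝ) : Prop where
  isProbabilityMeasure : IsProbabilityMeasure F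
  continuousOn : ContinuousOn f (Ioo 0 1)
  nonneg : ∀ x ∈ Ioo (0 : ℝ) 1, 0 ≤ f x
  eq_withDensity :
    F = (volume.restrict (Icc (0 : ℝ) 1)).withDensity (fun x => ENNReal.ofReal (f x))
  strictMonoOn_cdf : StrictMonoOn (cdf F) (Icc 0 1)

/-- The inverse distribution function: for `p ∈ [0,1]`, the number `x ∈ [0,1]` with `F(x) = p`. -/
def invCdf (F : Measure ℝ) (p : ℝ) : ℝ := Function.invFunOn (cdf F) (Icc 0 1) p

/-- Logarithmic loss `L(p) = 2 log I(1 - 2p) + log I(p)`. -/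
def logLoss (F : Measure ℝ) (p : ℝ) : ℝ :=
  2 * Real.log (invCdf F (1 - 2 * p)) + Real.log (invCdf F p)

/-- The constant loss of the middle interval of percentiles `[p, 1 - 2p]`, for `p < 1/3`:
the exponential of three times the average of `log I` over that interval. -/
def mixedLoss (F : Measure ℝ) (p : ℝ) : ℝ :=
  Real.exp (1 / (1 / 3 - p) * ∫ s in p..(1 - 2 * p), Real.log (invCdf F s))

/-- The equation that pins down an interior lower percentile bound. -/
def CutoffEquation (F : Measure ℝ) (p : ℝ) : Prop :=
  mixedLoss F p = invCdf F (1 - 2 * p) ^ 2 * invCdf F p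

/-- The lower percentile bound, in `(0, 1/3]`. At `p = 1/3` the middle interval is a point and the
average in `mixedLoss` degenerates: this value is taken exactly when no `q < 1/3` solves the
equation, and then there is no middle interval. -/
def IsLowerBound (F : Measure ℝ) (p : ℝ) : Prop :=
  (p ∈ Ioo (0 : ℝ) (1 / 3) ∧ CutoffEquation F p) ∨
    (p = 1 / 3 ∧ ∀ q ∈ Ioo (0 : ℝ) (1 / 3), ¬ CutoffEquation F q)

/-- The assumption on the common distribution: (a) `x f(x)` is nondecreasing on the middle
interval; (b) the logarithmic loss is concave. As `L(0) = -∞`, concavity on `[0,1/3]` is concavity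
on `(0,1/3]`. -/
structure DistributionAssumption (F : Measure ℝ) (f : ℝ → ℝ) (pl : ℝ) : Prop where
  monotoneOn : MonotoneOn (fun x => x * f x) (Icc (invCdf F pl) (invCdf F (1 - 2 * pl)))
  concaveOn : ConcaveOn ℝ (Ioc 0 (1 / 3)) (logLoss F)

/-- The marginal product of the worker `x`, at percentile `p = F(x)`. -/
def marginalProduct (F : Measure ℝ) (pl x : ℝ) : ℝ :=
  if cdf F x ≤ pl then
    -(invCdf F (1 - 2 * cdf F x)) ^ 2
  else if cdf F x < 1 - 2 * pl then
    -(mixedLoss F pl / invCdf F (cdf F x))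
  else
    -(invCdf F (cdf F x) * invCdf F ((1 - cdf F x) / 2))

/-- Feasible assignments: measures on triples (worker, coworker, firm) with the given marginals. -/
structure IsAssignment (Fx Fz : Measure ℝ) (π : Measure (ℝ × ℝ × ℝ)) : Prop where
  isProbabilityMeasure : IsProbabilityMeasure π
  map_worker : π.map (fun t => t.1) = Fx
  map_coworker : π.map (fun t => t.2.1) = Fx
  map_firm : π.map (fun t => t.2.2) = Fz

/-- Solutions of the planning problem: feasible assignments of maximal output. -/
def IsPlanningSolution (Fx Fz : Measure ℝ) (π : Measure (ℝ × ℝ × ℝ)) : Prop :=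
  IsAssignment Fx Fz π ∧ ∀ π', IsAssignment Fx Fz π' →
    ∫ t, output t.1 t.2.1 t.2.2 ∂π' ≤ ∫ t, output t.1 t.2.1 t.2.2 ∂π

/-- Feasible pairs of the dual problem: integrable wages and firm values that leave no positive
surplus at any triple of types in `[0,1]³`. -/
structure IsDualFeasible (Fx Fz : Measure ℝ) (w v : ℝ → ℝ) : Prop where
  integrable_wage : Integrable w Fx
  integrable_value : Integrable v Fz
  surplus_nonpos : ∀ x₁ ∈ Icc (0 : ℝ) 1, ∀ x₂ ∈ Icc (0 : ℝ) 1, ∀ z ∈ Icc (0 : ℝ) 1,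
    output x₁ x₂ z - w x₁ - w x₂ - v z ≤ 0

/-- The objective of the dual problem. -/
def dualValue (Fx Fz : Measure ℝ) (w v : ℝ → ℝ) : ℝ :=
  (∫ x, w x ∂Fx) + (∫ x, w x ∂Fx) + ∫ z, v z ∂Fz

/-- Solutions of the dual problem: feasible pairs of minimal value. -/
def IsDualSolution (Fx Fz : Measure ℝ) (w v : ℝ → ℝ) : Prop :=
  IsDualFeasible Fx Fz w v ∧
    ∀ w' v', IsDualFeasible Fx Fz w' v' → dualValue Fx Fz w v ≤ dualValue Fx Fz w' v'

end TeamSorting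

end

/-!
Let `I` be the inverse distribution function and put `g = -m`. Maximising output amounts to
minimising the expected loss `∫ x y z dπ` over the couplings of three copies of `F`. The proof
exhibits a solution of the dual problem and a coupling that together satisfy complementary
slackness.

*The dual solution.* Let `φ` be the primitive of `g` and `Φ(x, y, z) = x y z - φ x - φ y - φ z`. By
definition of `m`, the function `x g(x)` of the percentile `p = F(x)` is `Λ(q) = I(q) I(1 - 2q)²`
at `p = q` and `p = 1 - 2q` for `q ≤ pl`, and is constant, equal to `Λ(pl)`, in between. The cutoff
equation says that the average of `L = log Λ` over `[pl, 1/3]` is `L(pl)`, so by concavity `L` is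
nondecreasing up to `pl`, and strictly so below its maximal value there
(`IsTypeDistribution.monotoneOn_logLoss`, `IsTypeDistribution.tailLoss_lt_tailLoss`). If the
equation has no solution, the average exceeds the value everywhere and `pl = 1/3`, with the same
conclusion. At a minimiser of `Φ` in the interior of the cube, `x g(x) = y g(y) = z g(z) = x y z`. Hence the
minimiser is a tail team, of percentiles `q`, `1 - 2q`, `1 - 2q`, or it consists of three types at
which `g` is `Λ(pl) / x`. The function `Φ` is constant along the tail
(`IsTypeDistribution.reducedLoss_tail`), and depends only on the product `x y z` where `φ` is a
logarithm. It therefore has the same value at all of these triples, which is its minimum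
(`IsTypeDistribution.minLoss_le_reducedLoss`). So the wages `-φ(x)` and the firm values `z - φ(z)`,
up to constants, are feasible.

*The coupling.* By the Riesz extension and representation theorems, a coupling of three copies of
`F` concentrated on the minimisers of `Φ` exists as soon as `∫ u dF ≥ 0` for every continuous `u`
such that `u x + u y + u z ≥ 0` at all minimisers (`exists_coupling_of_forall_integral_nonneg`).
The tail teams account for the percentiles outside `[pl, 1 - 2 pl]`. In the coordinate
`t = log (b / x) / log (b / a)` of the middle types `[a, b]`, the triples with product `a b²` form
the simplex `t₁ + t₂ + t₃ = 1`; the density of `t` is nonincreasing by hypothesis, and has mean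
`1/3` by the cutoff equation. What remains is a dual form of the joint mixability of monotone
densities (`integral_mul_nonneg_of_simplex`). Subtracting a multiple of `t - 1/3` from `u` makes
all the integrals `∫₀ˢ u` nonnegative; otherwise the most negative averages over `[0, s]` would
contradict the integral of the hypothesis along a segment of the simplex.

*The conclusions.* By complementary slackness every optimal coupling is concentrated on minimisers
of `Φ`, where the first-order conditions are the formula for the marginal product. Conversely, the
slack of any dual solution vanishes almost everywhere under the coupling, so that the affine
functions coming from tight triples support continuous wages at each type with slope `m`
(`IsTypeDistribution.contDiffOn_dualSolution`). An arbitrary dual solution becomes continuous by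
conjugation (`IsTypeDistribution.exists_continuous_dualSolution`).
-/

/-! ### The distribution function and its inverse -/

namespace TeamSorting

open Filter Topology

lemma cdf_mem_Icc (F : Measure ℝ) (x : ℝ) : cdf F x ∈ Icc (0 : ℝ) 1 :=
  ⟨cdf_nonneg F x, cdf_le_one F x⟩

namespace IsTypeDistribution

variable {F : Measure ℝ} {f : ℝ → ℝ}

lemma absolutelyContinuous (hF : IsTypeDistribution F f) : F ≪ volume := by
  rw [hF.eq_withDensity]
  exact (withDensity_absolutelyContinuous _ _).trans Measure.restrict_le_self.absolutelyContinuous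

lemma measure_singleton (hF : IsTypeDistribution F f) (x : ℝ) : F {x} = 0 :=
  hF.absolutelyContinuous (by simp)

lemma ae_mem_Icc (hF : IsTypeDistribution F f) : ∀ᵐ x ∂F, x ∈ Icc (0 : ℝ) 1 := by
  have h : F ≪ volume.restrict (Icc (0 : ℝ) 1) := by
    conv_lhs => rw [hF.eq_withDensity]
    exact withDensity_absolutelyContinuous _ _
  exact h.ae_le (ae_restrict_mem measurableSet_Icc)

lemma ae_mem_Ioo (hF : IsTypeDistribution F f) : ∀ᵐ x ∂F, x ∈ Ioo (0 : ℝ) 1 := by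
  have h (a : ℝ) : ∀ᵐ x ∂F, x ≠ a := by
    rw [ae_iff]; simpa using hF.measure_singleton a
  filter_upwards [hF.ae_mem_Icc, h 0, h 1] with x hx h0 h1
  exact ⟨lt_of_le_of_ne hx.1 (Ne.symm h0), lt_of_le_of_ne hx.2 h1⟩

lemma cdf_zero (hF : IsTypeDistribution F f) : cdf F 0 = 0 := by
  have := hF.isProbabilityMeasure
  rw [cdf_eq_real, measureReal_def, ENNReal.toReal_eq_zero_iff]
  left
  refine measure_mono_null (t := {x | ¬ x ∈ Ioo (0 : ℝ) 1}) ?_ hF.ae_mem_Ioo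
  intro x hx h
  exact absurd h.1 (not_lt.2 hx)

lemma cdf_one (hF : IsTypeDistribution F f) : cdf F 1 = 1 := by
  have := hF.isProbabilityMeasure
  rw [cdf_eq_real, measureReal_def]
  have : F (Iic 1) = 1 := by
    rw [prob_compl_eq_zero_iff measurableSet_Iic |>.symm]
    refine measure_mono_null (t := {x | ¬ x ∈ Ioo (0 : ℝ) 1}) ?_ hF.ae_mem_Ioo
    intro x hx h
    exact hx h.2.le
  simp [this]

lemma continuous_cdf (hF : IsTypeDistribution F f) : Continuous (cdf F) := by
  have := hF.isProbabilityMeasure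
  rw [continuous_iff_continuousAt]
  intro x
  have h := (cdf F).measure_singleton x
  rw [measure_cdf, hF.measure_singleton] at h
  have h1 : Function.leftLim (cdf F) x = cdf F x := by
    have h2 := ENNReal.ofReal_eq_zero.1 h.symm
    have h3 := (monotone_cdf F).leftLim_le (le_refl x)
    linarith
  rw [continuousAt_iff_continuous_left_right]
  refine ⟨?_, (cdf F).right_continuous x⟩
  rw [← continuousWithinAt_Iio_iff_Iic, ContinuousWithinAt]
  have := (monotone_cdf F).tendsto_leftLim x
  rwa [h1] at this

lemma surjOn_cdf (hF : IsTypeDistribution F f) : SurjOn (cdf F) (Icc 0 1) (Icc 0 1) := by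
  have := intermediate_value_Icc (zero_le_one' ℝ) hF.continuous_cdf.continuousOn
  rwa [hF.cdf_zero, hF.cdf_one] at this

lemma invCdf_mem (hF : IsTypeDistribution F f) {p : ℝ} (hp : p ∈ Icc (0 : ℝ) 1) :
    invCdf F p ∈ Icc (0 : ℝ) 1 :=
  Function.invFunOn_mem (hF.surjOn_cdf hp)

lemma cdf_invCdf (hF : IsTypeDistribution F f) {p : ℝ} (hp : p ∈ Icc (0 : ℝ) 1) :
    cdf F (invCdf F p) = p :=
  Function.invFunOn_eq (hF.surjOn_cdf hp)

lemma invCdf_cdf (hF : IsTypeDistribution F f) {x : ℝ} (hx : x ∈ Icc (0 : ℝ) 1) :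
    invCdf F (cdf F x) = x :=
  hF.strictMonoOn_cdf.injOn (hF.invCdf_mem (cdf_mem_Icc F x)) hx (hF.cdf_invCdf (cdf_mem_Icc F x))

lemma invCdf_zero (hF : IsTypeDistribution F f) : invCdf F 0 = 0 := by
  have := hF.invCdf_cdf (x := 0) (by simp)
  rwa [hF.cdf_zero] at this

lemma invCdf_one (hF : IsTypeDistribution F f) : invCdf F 1 = 1 := by
  have := hF.invCdf_cdf (x := 1) (by simp)
  rwa [hF.cdf_one] at this

lemma strictMonoOn_invCdf (hF : IsTypeDistribution F f) :
    StrictMonoOn (invCdf F) (Icc 0 1) := by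
  intro p hp q hq hpq
  rw [← hF.strictMonoOn_cdf.lt_iff_lt (hF.invCdf_mem hp) (hF.invCdf_mem hq), hF.cdf_invCdf hp,
    hF.cdf_invCdf hq]
  exact hpq

lemma invCdf_pos (hF : IsTypeDistribution F f) {p : ℝ} (h0 : 0 < p) (h1 : p ≤ 1) :
    0 < invCdf F p := by
  have := hF.strictMonoOn_invCdf (left_mem_Icc.2 zero_le_one) ⟨h0.le, h1⟩ h0
  rwa [hF.invCdf_zero] at this

lemma invCdf_lt_one (hF : IsTypeDistribution F f) {p : ℝ} (h0 : 0 ≤ p) (h1 : p < 1) :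
    invCdf F p < 1 := by
  have := hF.strictMonoOn_invCdf ⟨h0, h1.le⟩ (right_mem_Icc.2 zero_le_one) h1
  rwa [hF.invCdf_one] at this

lemma continuousOn_invCdf (hF : IsTypeDistribution F f) :
    ContinuousOn (invCdf F) (Icc 0 1) := by
  let e : Icc (0 : ℝ) 1 → Icc (0 : ℝ) 1 := fun x => ⟨cdf F x, cdf_mem_Icc F x⟩
  have he : StrictMono e := fun x y hxy => hF.strictMonoOn_cdf x.2 y.2 hxy
  have hs : Function.Surjective e := by
    rintro ⟨p, hp⟩
    obtain ⟨x, hx, rfl⟩ := hF.surjOn_cdf hp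
    exact ⟨⟨x, hx⟩, rfl⟩
  have hc := (he.orderIsoOfSurjective e hs).symm.continuous
  rw [continuousOn_iff_continuous_domRestrict]
  convert continuous_subtype_val.comp hc using 1
  ext p
  obtain ⟨x, rfl⟩ := hs p
  have : (he.orderIsoOfSurjective e hs).symm (e x) = x :=
    (he.orderIsoOfSurjective e hs).symm_apply_apply x
  simp only [Function.comp_apply, this, domRestrict_apply]
  exact hF.invCdf_cdf x.2

lemma measurable_invCdf_restrict (hF : IsTypeDistribution F f) :
    AEMeasurable (invCdf F) (volume.restrict (Icc (0 : ℝ) 1)) :=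
  hF.continuousOn_invCdf.aemeasurable measurableSet_Icc

/-- Quantile transform: the inverse distribution function carries the uniform distribution on
`[0,1]` to `F`. -/
lemma map_invCdf (hF : IsTypeDistribution F f) :
    (volume.restrict (Icc (0 : ℝ) 1)).map (invCdf F) = F := by
  have := hF.isProbabilityMeasure
  have hprob : IsProbabilityMeasure (volume.restrict (Icc (0 : ℝ) 1)) := ⟨by simp⟩
  have h2 := Measure.isProbabilityMeasure_map hF.measurable_invCdf_restrict
  refine Measure.ext_of_Iic _ _ fun x => ?_
  rw [Measure.map_apply_of_aemeasurable hF.measurable_invCdf_restrict measurableSet_Iic,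
    ← ofReal_cdf]
  have h3 : volume ((invCdf F ⁻¹' Iic x) ∩ Icc 0 1) = volume (Icc 0 (cdf F x)) := by
    rcases lt_trichotomy x 0 with hx | hx | hx
    · have h0 : cdf F x = 0 := le_antisymm ((monotone_cdf F hx.le).trans_eq hF.cdf_zero)
        (cdf_nonneg F x)
      have h1 : (invCdf F ⁻¹' Iic x) ∩ Icc 0 1 = ∅ := by
        refine eq_empty_of_forall_notMem fun p hp => ?_
        have h2 := (hF.invCdf_mem hp.2).1
        have h3 : invCdf F p ≤ x := hp.1
        linarith
      simp [h0, h1]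
    all_goals
      congr 1
      ext p
      simp only [mem_inter_iff, mem_preimage, mem_Iic, mem_Icc]
      constructor
      · rintro ⟨h, hp⟩
        refine ⟨hp.1, ?_⟩
        have := monotone_cdf F h
        rwa [hF.cdf_invCdf hp] at this
      · rintro ⟨h, hp⟩
        have hp1 := hp.trans (cdf_le_one F x)
        refine ⟨?_, h, hp1⟩
        rcases le_total x 1 with hx1 | hx1
        · have := hF.strictMonoOn_invCdf.monotoneOn ⟨h, hp1⟩ (cdf_mem_Icc F x) hp
          rwa [hF.invCdf_cdf ⟨by linarith, hx1⟩] at this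
        · exact (hF.invCdf_mem ⟨h, hp1⟩).2.trans hx1
  have h4 : NullMeasurableSet (invCdf F ⁻¹' Iic x) (volume.restrict (Icc (0 : ℝ) 1)) :=
    hF.measurable_invCdf_restrict.nullMeasurableSet_preimage measurableSet_Iic
  rw [Measure.restrict_apply₀ h4, h3, Real.volume_Icc, sub_zero]

lemma integral_eq_intervalIntegral_invCdf (hF : IsTypeDistribution F f) {g : ℝ → ℝ}
    (hg : Continuous g) : ∫ x, g x ∂F = ∫ p in (0 : ℝ)..1, g (invCdf F p) := by
  conv_lhs => rw [← hF.map_invCdf]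
  rw [integral_map hF.measurable_invCdf_restrict hg.aestronglyMeasurable,
    intervalIntegral.integral_of_le zero_le_one, integral_Icc_eq_integral_Ioc]

/-- The distribution has full support on `[0,1]`: a property that holds almost everywhere holds
on a dense set of types. -/
lemma subset_closure_of_ae (hF : IsTypeDistribution F f) {P : ℝ → Prop} (hP : ∀ᵐ x ∂F, P x) :
    Icc (0 : ℝ) 1 ⊆ closure {x | x ∈ Icc (0 : ℝ) 1 ∧ P x} := by
  have := hF.isProbabilityMeasure
  have key : ∀ a b : ℝ, 0 ≤ a → a < b → b ≤ 1 → ∃ x ∈ Ioo a b, P x := by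
    intro a b ha hab hb
    by_contra hcon
    push Not at hcon
    have h0 : F (Ioo a b) = 0 :=
      measure_mono_null (fun x hx => hcon x hx) hP
    have h1 : F (Ioc a b) = 0 := by
      rw [← Ioo_union_right hab]
      exact measure_union_null h0 (hF.measure_singleton b)
    have h2 := (cdf F).measure_Ioc a b
    rw [measure_cdf, h1] at h2
    have h3 := hF.strictMonoOn_cdf ⟨ha, hab.le.trans hb⟩ ⟨ha.trans hab.le, hb⟩ hab
    have h4 := ENNReal.ofReal_eq_zero.1 h2.symm
    linarith
  have h1 : Ioo (0 : ℝ) 1 ⊆ closure {x | x ∈ Icc (0 : ℝ) 1 ∧ P x} := by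
    intro x hx
    rw [Metric.mem_closure_iff]
    intro ε hε
    obtain ⟨y, hy, hPy⟩ := key x (min (x + ε) 1) hx.1.le (lt_min (by linarith) hx.2)
      (min_le_right _ _)
    have hy1 := hy.2.trans_le (min_le_left _ _)
    have hy2 := hy.2.trans_le (min_le_right _ _)
    refine ⟨y, ⟨⟨by linarith [hx.1, hy.1], hy2.le⟩, hPy⟩, ?_⟩
    rw [Real.dist_eq, abs_lt]
    constructor <;> linarith [hy.1]
  have h2 := closure_minimal h1 isClosed_closure
  rwa [closure_Ioo (zero_ne_one' ℝ)] at h2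

/-- The distribution function is differentiable, with derivative the density. -/
lemma hasDerivAt_cdf (hF : IsTypeDistribution F f) {x : ℝ} (hx : x ∈ Ioo (0 : ℝ) 1) :
    HasDerivAt (cdf F) (f x) x := by
  have := hF.isProbabilityMeasure
  -- on a compact interval around `x` the density is continuous
  obtain ⟨a, ha0, hax⟩ := exists_between hx.1
  obtain ⟨b, hxb, hb1⟩ := exists_between hx.2
  have hsub : Icc a b ⊆ Ioo (0 : ℝ) 1 := fun y hy => ⟨ha0.trans_le hy.1, hy.2.trans_lt hb1⟩
  have hcont : ContinuousOn f (Icc a b) := hF.continuousOn.mono hsub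
  have hint : IntegrableOn f (Icc a b) := hcont.integrableOn_Icc
  have hcdf : ∀ y ∈ Ioo a b, cdf F y = cdf F a + ∫ t in a..y, f t := by
    intro y hy
    have h1 := (cdf F).measure_Ioc a y
    rw [measure_cdf, hF.eq_withDensity, withDensity_apply' _ (Ioc a y),
      Measure.restrict_restrict measurableSet_Ioc] at h1
    have h2 : Ioc a y ∩ Icc (0 : ℝ) 1 = Ioc a y := by
      refine inter_eq_left.2 fun t ht => ⟨ha0.le.trans ht.1.le, (ht.2.trans hy.2.le).trans hb1.le⟩
    have hs : Ioc a y ⊆ Icc a b := fun t ht => ⟨ht.1.le, ht.2.trans hy.2.le⟩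
    rw [h2, ← ofReal_integral_eq_lintegral_ofReal (hint.mono_set hs)
      ((ae_restrict_iff' measurableSet_Ioc).2
        (Filter.Eventually.of_forall fun t ht => hF.nonneg t (hsub (hs ht)))),
      ← intervalIntegral.integral_of_le hy.1.le, ← hF.eq_withDensity] at h1
    have h3 : 0 ≤ ∫ t in a..y, f t := intervalIntegral.integral_nonneg hy.1.le
      fun t ht => hF.nonneg t (hsub ⟨ht.1, ht.2.trans hy.2.le⟩)
    have h4 : 0 ≤ cdf F y - cdf F a := sub_nonneg.2 (monotone_cdf F hy.1.le)
    have h5 := (ENNReal.ofReal_eq_ofReal_iff h3 h4).1 h1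
    linarith
  have hder : HasDerivAt (fun y => cdf F a + ∫ t in a..y, f t) (f x) x := by
    refine HasDerivAt.const_add _ ?_
    refine intervalIntegral.integral_hasDerivAt_right ?_ ?_ ?_
    · exact (hcont.mono (Icc_subset_Icc_right hxb.le)).intervalIntegrable_of_Icc hax.le
    · exact (hcont.mono Ioo_subset_Icc_self).stronglyMeasurableAtFilter isOpen_Ioo x ⟨hax, hxb⟩
    · exact hcont.continuousAt (Icc_mem_nhds hax hxb)
  refine hder.congr_of_eventuallyEq ?_
  filter_upwards [Ioo_mem_nhds hax hxb] with y hy using hcdf y hy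

end IsTypeDistribution

end TeamSorting

/-! ### Concavity of the loss and the cutoff equation -/

namespace TeamSorting

open Filter Topology

section Concave

variable {L : ℝ → ℝ} {c : ℝ}

lemma _root_.ConcaveOn.lt_of_lt_left {s : Set ℝ} (hL : ConcaveOn ℝ s L) {a b x : ℝ}
    (ha : a ∈ s) (hx : x ∈ s) (hab : a < b) (hbx : b < x) (h : L b < L a) : L x < L b := by
  have h1 := hL.slope_anti_adjacent ha hx hab hbx
  have h2 : (L b - L a) / (b - a) < 0 := div_neg_of_neg_of_pos (by linarith) (by linarith)
  have h3 := h1.trans_lt h2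
  rw [div_lt_iff₀ (by linarith)] at h3
  linarith

lemma _root_.ConcaveOn.lt_of_lt_right {s : Set ℝ} (hL : ConcaveOn ℝ s L) {a b x : ℝ}
    (ha : a ∈ s) (hx : x ∈ s) (hab : a < b) (hbx : b < x) (h : L a < L x) : L a < L b := by
  by_contra hcon
  rcases (not_lt.1 hcon).lt_or_eq with h1 | h1
  · linarith [hL.lt_of_lt_left ha hx hab hbx h1]
  · have h2 := hL.slope_anti_adjacent ha hx hab hbx
    rw [h1, sub_self, zero_div, div_le_iff₀ (by linarith)] at h2
    linarith

/-- If the average of a concave function over `[p, c]` equals its value at `p`, then the function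
is nondecreasing up to `p`: a decrease would persist, and pull the average below. -/
lemma monotoneOn_of_integral_eq_zero (hL : ConcaveOn ℝ (Ioc 0 c) L)
    (hc : ContinuousOn L (Ioc 0 c)) {p : ℝ} (hp : p ∈ Ioo 0 c)
    (h : ∫ q in p..c, (L q - L p) = 0) : MonotoneOn L (Ioc 0 p) := by
  intro a ha b hb hab
  by_contra hcon
  rw [not_le] at hcon
  have hab' : a < b := lt_of_le_of_ne hab (by rintro rfl; exact lt_irrefl _ hcon)
  have hlt : ∀ x ∈ Ioc p c, L x < L p := by
    intro x hx
    rcases hb.2.eq_or_lt with rfl | hbp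
    · exact hL.lt_of_lt_left ⟨ha.1, hab.trans hp.2.le⟩ ⟨hp.1.trans hx.1, hx.2⟩ hab' hx.1 hcon
    · refine hL.lt_of_lt_left ⟨hb.1, hb.2.trans hp.2.le⟩ ⟨hp.1.trans hx.1, hx.2⟩ hbp hx.1 ?_
      exact hL.lt_of_lt_left ⟨ha.1, hab.trans (hb.2.trans hp.2.le)⟩ ⟨hp.1, hp.2.le⟩ hab' hbp hcon
  have hcont : ContinuousOn (fun q => -(L q - L p)) (Icc p c) :=
    ((hc.mono fun x hx => ⟨hp.1.trans_le hx.1, hx.2⟩).sub continuousOn_const).neg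
  have := intervalIntegral.integral_pos hp.2 hcont
    (fun x hx => by linarith [hlt x hx]) ⟨c, right_mem_Icc.2 hp.2.le, by
      linarith [hlt c (right_mem_Ioc.2 hp.2)]⟩
  rw [intervalIntegral.integral_neg, h] at this
  simp at this

/-- If a concave function diverges to `-∞` at `0` and its average over `[p, c]` is nowhere equal to
its value at `p`, then it is nondecreasing. -/
lemma monotoneOn_of_integral_ne_zero (hc0 : 0 < c) (hL : ConcaveOn ℝ (Ioc 0 c) L)
    (hc : ContinuousOn L (Ioc 0 c)) (hbot : Tendsto L (𝓝[>] 0) atBot)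
    (h : ∀ p ∈ Ioo 0 c, ∫ q in p..c, (L q - L p) ≠ 0) : MonotoneOn L (Ioc 0 c) := by
  have hint : ∀ p ∈ Ioo 0 c, IntervalIntegrable L volume p c := fun p hp =>
    (hc.mono fun x hx => ⟨hp.1.trans_le hx.1, hx.2⟩).intervalIntegrable_of_Icc hp.2.le
  -- the excess of the average is positive somewhere, hence everywhere
  obtain ⟨p₀, hp₀, hL₀⟩ : ∃ p₀ ∈ Ioo 0 c, L p₀ < L c := by
    have h1 := (hbot.eventually_lt_atBot (L c)).and (Ioo_mem_nhdsGT hc0)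
    obtain ⟨p, h2, h3⟩ := h1.exists
    exact ⟨p, h3, h2⟩
  have hpos₀ : 0 < ∫ q in p₀..c, (L q - L p₀) := by
    refine intervalIntegral.integral_pos hp₀.2 ?_ (fun x hx => ?_)
      ⟨c, right_mem_Icc.2 hp₀.2.le, by linarith⟩
    · exact (hc.mono fun x hx => ⟨hp₀.1.trans_le hx.1, hx.2⟩).sub continuousOn_const
    · rcases hx.2.eq_or_lt with rfl | hxc
      · linarith
      · linarith [hL.lt_of_lt_right ⟨hp₀.1, hp₀.2.le⟩ ⟨hc0, le_rfl⟩ hx.1 hxc hL₀]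
  have hpos : ∀ p ∈ Ioo 0 c, 0 < ∫ q in p..c, (L q - L p) := by
    intro p hp
    by_contra hcon
    have hcontD : ContinuousOn (fun p => ∫ q in p..c, (L q - L p)) (Ioo 0 c) := by
      have h1 : ∀ p ∈ Ioo 0 c, ∫ q in p..c, (L q - L p) = (∫ q in p..c, L q) - (c - p) * L p := by
        intro p hp
        rw [intervalIntegral.integral_sub (hint p hp) intervalIntegrable_const]
        simp
      refine ContinuousOn.congr ?_ h1
      refine ContinuousOn.sub ?_ ((continuousOn_const.sub continuousOn_id).mul
        (hc.mono Ioo_subset_Ioc_self))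
      intro p hp
      have h2 : HasDerivAt (fun p => ∫ q in p..c, L q) (-L p) p :=
        intervalIntegral.integral_hasDerivAt_left (hint p hp)
          ((hc.mono Ioo_subset_Ioc_self).stronglyMeasurableAtFilter isOpen_Ioo p hp)
          ((hc.mono Ioo_subset_Ioc_self).continuousAt (Ioo_mem_nhds hp.1 hp.2))
      exact h2.continuousAt.continuousWithinAt
    obtain ⟨p', hp', h0⟩ := isPreconnected_Ioo.intermediate_value hp hp₀ hcontD
      (show (0 : ℝ) ∈ Icc _ _ from ⟨not_lt.1 hcon, hpos₀.le⟩)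
    exact h p' hp' h0
  intro a ha b hb hab
  by_contra hcon
  rw [not_le] at hcon
  have hab' : a < b := lt_of_le_of_ne hab (by rintro rfl; exact lt_irrefl _ hcon)
  obtain ⟨b', hb'a, hb'c, hlt⟩ : ∃ b', a < b' ∧ b' < c ∧ L b' < L a := by
    rcases hb.2.lt_or_eq with h1 | rfl
    · exact ⟨b, hab', h1, hcon⟩
    · have h2 : ContinuousWithinAt L (Ioo a b) b :=
        (hc b hb).mono fun x hx => ⟨ha.1.trans hx.1, hx.2.le⟩
      have : (𝓝[Ioo a b] b).NeBot := right_nhdsWithin_Ioo_neBot hab'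
      obtain ⟨b', h3, h4⟩ := ((h2.eventually_lt_const hcon).and self_mem_nhdsWithin).exists
      exact ⟨b', h4.1, h4.2, h3⟩
  have h1 : ∫ q in b'..c, (L q - L b') ≤ 0 := by
    rw [← neg_nonneg, ← intervalIntegral.integral_neg]
    refine intervalIntegral.integral_nonneg hb'c.le fun x hx => ?_
    rcases hx.1.eq_or_lt with rfl | h2
    · simp
    · linarith [hL.lt_of_lt_left ha ⟨ha.1.trans (hb'a.trans h2), hx.2⟩ hb'a h2 hlt]
  exact absurd (hpos b' ⟨ha.1.trans hb'a, hb'c⟩) (not_lt.2 h1)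

end Concave

/-- The loss `I(q) I(1 - 2q)²` of the team whose members have the percentiles `q`, `1 - 2q` and
`1 - 2q`. -/
noncomputable def tailLoss (F : Measure ℝ) (q : ℝ) : ℝ := invCdf F q * invCdf F (1 - 2 * q) ^ 2

lemma IsLowerBound.mem_Ioc {F : Measure ℝ} {pl : ℝ} (h : IsLowerBound F pl) :
    pl ∈ Ioc (0 : ℝ) (1 / 3) := by
  rcases h with h | h
  · exact ⟨h.1.1, h.1.2.le⟩
  · rw [h.1]; norm_num

lemma IsLowerBound.mixedLoss_eq {F : Measure ℝ} {pl : ℝ} (hpl : IsLowerBound F pl)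
    (h : pl < 1 / 3) : mixedLoss F pl = tailLoss F pl := by
  rcases hpl with h1 | h1
  · rw [h1.2, tailLoss, mul_comm]
  · exact absurd h1.1 h.ne

namespace IsTypeDistribution

variable {F : Measure ℝ} {f : ℝ → ℝ} {pl : ℝ}

lemma continuousOn_invCdf_one_sub (hF : IsTypeDistribution F f) :
    ContinuousOn (fun q => invCdf F (1 - 2 * q)) (Icc 0 (1 / 3)) :=
  hF.continuousOn_invCdf.comp (by fun_prop) fun q hq => ⟨by linarith [hq.2], by linarith [hq.1]⟩

lemma continuousOn_tailLoss (hF : IsTypeDistribution F f) :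
    ContinuousOn (tailLoss F) (Icc 0 (1 / 3)) :=
  (hF.continuousOn_invCdf.mono fun q hq => ⟨hq.1, by linarith [hq.2]⟩).mul
    (hF.continuousOn_invCdf_one_sub.pow 2)

lemma tailLoss_zero (hF : IsTypeDistribution F f) : tailLoss F 0 = 0 := by
  simp [tailLoss, hF.invCdf_zero]

lemma tailLoss_pos (hF : IsTypeDistribution F f) {q : ℝ} (hq : q ∈ Ioc (0 : ℝ) (1 / 3)) :
    0 < tailLoss F q :=
  mul_pos (hF.invCdf_pos hq.1 (by linarith [hq.2]))
    (pow_pos (hF.invCdf_pos (by linarith [hq.2]) (by linarith [hq.1])) 2)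

lemma log_tailLoss (hF : IsTypeDistribution F f) {q : ℝ} (hq : q ∈ Ioc (0 : ℝ) (1 / 3)) :
    Real.log (tailLoss F q) = logLoss F q := by
  have h1 := hF.invCdf_pos hq.1 (by linarith [hq.2])
  have h2 := hF.invCdf_pos (p := 1 - 2 * q) (by linarith [hq.2]) (by linarith [hq.1])
  rw [tailLoss, Real.log_mul h1.ne' (pow_pos h2 2).ne', Real.log_pow, logLoss]
  push_cast; ring

lemma continuousOn_logLoss (hF : IsTypeDistribution F f) :
    ContinuousOn (logLoss F) (Ioc 0 (1 / 3)) :=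
  ((hF.continuousOn_tailLoss.mono Ioc_subset_Icc_self).log
    fun _ hq => (hF.tailLoss_pos hq).ne').congr fun _ hq => (hF.log_tailLoss hq).symm

lemma tendsto_logLoss (hF : IsTypeDistribution F f) :
    Tendsto (logLoss F) (𝓝[>] 0) atBot := by
  have h1 : Tendsto (tailLoss F) (𝓝[Ioc 0 (1 / 3)] 0) (𝓝[>] 0) := by
    refine tendsto_nhdsWithin_iff.2 ⟨?_, ?_⟩
    · have := (hF.continuousOn_tailLoss 0 (by norm_num)).mono Ioc_subset_Icc_self
      rw [ContinuousWithinAt, hF.tailLoss_zero] at this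
      exact this
    · filter_upwards [self_mem_nhdsWithin] with q hq using hF.tailLoss_pos hq
  have h2 := Real.tendsto_log_nhdsGT_zero.comp h1
  have h3 : 𝓝[Ioc (0 : ℝ) (1 / 3)] 0 = 𝓝[>] 0 := nhdsWithin_Ioc_eq_nhdsGT (by norm_num)
  rw [← h3]
  refine h2.congr' ?_
  filter_upwards [self_mem_nhdsWithin] with q hq using hF.log_tailLoss hq

lemma continuousOn_log_invCdf (hF : IsTypeDistribution F f) :
    ContinuousOn (fun s => Real.log (invCdf F s)) (Ioc 0 1) :=
  (hF.continuousOn_invCdf.mono Ioc_subset_Icc_self).log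
    fun _ hs => (hF.invCdf_pos hs.1 hs.2).ne'

/-- The integral of `log I` over `[p, 1 - 2p]` is that of the logarithmic loss over `[p, 1/3]`. -/
lemma integral_log_invCdf (hF : IsTypeDistribution F f) {p : ℝ} (hp : p ∈ Ioc (0 : ℝ) (1 / 3)) :
    ∫ s in p..(1 - 2 * p), Real.log (invCdf F s) = ∫ q in p..(1 / 3), logLoss F q := by
  have hint : ∀ a b, 0 < a → a ≤ b → b ≤ 1 →
      IntervalIntegrable (fun s => Real.log (invCdf F s)) volume a b := fun a b h0 h1 h2 =>
    (hF.continuousOn_log_invCdf.mono fun x hx =>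
      ⟨h0.trans_le hx.1, hx.2.trans h2⟩).intervalIntegrable_of_Icc h1
  have hp1 := hp.1
  have hp2 := hp.2
  have h1 := hint p (1 / 3) hp.1 hp.2 (by norm_num)
  have h2 := hint (1 / 3) (1 - 2 * p) (by norm_num) (by linarith) (by linarith)
  rw [← intervalIntegral.integral_add_adjacent_intervals h1 h2]
  have h3 : ∫ s in (1 / 3)..(1 - 2 * p), Real.log (invCdf F s) =
      2 * ∫ q in p..(1 / 3), Real.log (invCdf F (1 - 2 * q)) := by
    have := intervalIntegral.integral_comp_sub_mul (fun s => Real.log (invCdf F s))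
      (a := p) (b := 1 / 3) (c := 2) two_ne_zero 1
    rw [this, show (1 : ℝ) - 2 * (1 / 3) = 1 / 3 by norm_num, smul_eq_mul]
    ring
  have h4 : IntervalIntegrable (fun q => Real.log (invCdf F (1 - 2 * q))) volume p (1 / 3) := by
    refine ContinuousOn.intervalIntegrable_of_Icc hp.2 ?_
    refine hF.continuousOn_log_invCdf.comp (f := fun q => 1 - 2 * q) (by fun_prop) fun q hq => ?_
    exact ⟨by linarith [hq.2], by linarith [hq.1]⟩
  rw [h3, ← intervalIntegral.integral_const_mul, ← intervalIntegral.integral_add h1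
    (h4.const_mul 2)]
  refine intervalIntegral.integral_congr fun q _ => ?_
  simp only [logLoss]; ring

lemma cutoffEquation_iff (hF : IsTypeDistribution F f) {p : ℝ} (hp : p ∈ Ioo (0 : ℝ) (1 / 3)) :
    CutoffEquation F p ↔ ∫ q in p..(1 / 3), (logLoss F q - logLoss F p) = 0 := by
  have hp' : p ∈ Ioc (0 : ℝ) (1 / 3) := ⟨hp.1, hp.2.le⟩
  have hd : (1 / 3 - p) ≠ 0 := by linarith [hp.2]
  have hint : IntervalIntegrable (logLoss F) volume p (1 / 3) :=
    (hF.continuousOn_logLoss.mono fun x hx => ⟨hp.1.trans_le hx.1, hx.2⟩).intervalIntegrable_of_Icc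
      hp.2.le
  rw [intervalIntegral.integral_sub hint intervalIntegrable_const,
    intervalIntegral.integral_const, smul_eq_mul, CutoffEquation, mixedLoss,
    hF.integral_log_invCdf hp', mul_comm (_ ^ 2)]
  change _ = tailLoss F p ↔ _
  rw [← Real.exp_log (hF.tailLoss_pos hp'), Real.exp_eq_exp, hF.log_tailLoss hp', sub_eq_zero,
    one_div_mul_eq_div, div_eq_iff hd, mul_comm (logLoss F p)]

lemma integral_log_invCdf_lowerBound (hF : IsTypeDistribution F f) (hpl : IsLowerBound F pl) :
    ∫ s in pl..(1 - 2 * pl), Real.log (invCdf F s) = (1 / 3 - pl) * logLoss F pl := by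
  rw [hF.integral_log_invCdf hpl.mem_Ioc]
  rcases hpl with h1 | h1
  · have h2 := (hF.cutoffEquation_iff h1.1).1 h1.2
    have hint : IntervalIntegrable (logLoss F) volume pl (1 / 3) :=
      (hF.continuousOn_logLoss.mono fun x hx =>
        ⟨h1.1.1.trans_le hx.1, hx.2⟩).intervalIntegrable_of_Icc h1.1.2.le
    rw [intervalIntegral.integral_sub hint intervalIntegrable_const,
      intervalIntegral.integral_const, smul_eq_mul] at h2
    linarith
  · simp [h1.1]

lemma monotoneOn_logLoss (hF : IsTypeDistribution F f) (hpl : IsLowerBound F pl)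
    (hL : ConcaveOn ℝ (Ioc 0 (1 / 3)) (logLoss F)) : MonotoneOn (logLoss F) (Ioc 0 pl) := by
  rcases hpl with h1 | h1
  · exact monotoneOn_of_integral_eq_zero hL hF.continuousOn_logLoss h1.1
      ((hF.cutoffEquation_iff h1.1).1 h1.2)
  · rw [h1.1]
    exact monotoneOn_of_integral_ne_zero (by norm_num) hL hF.continuousOn_logLoss
      hF.tendsto_logLoss fun p hp => mt (hF.cutoffEquation_iff hp).2 (h1.2 p hp)

lemma monotoneOn_tailLoss (hF : IsTypeDistribution F f) (hpl : IsLowerBound F pl)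
    (hL : ConcaveOn ℝ (Ioc 0 (1 / 3)) (logLoss F)) : MonotoneOn (tailLoss F) (Icc 0 pl) := by
  intro a ha b hb hab
  have hpl' := hpl.mem_Ioc.2
  rcases ha.1.eq_or_lt with rfl | ha0
  · rw [hF.tailLoss_zero]
    rcases hb.1.eq_or_lt with rfl | hb0
    · rw [hF.tailLoss_zero]
    · exact (hF.tailLoss_pos ⟨hb0, hb.2.trans hpl'⟩).le
  · have h1 := hF.tailLoss_pos ⟨ha0, ha.2.trans hpl'⟩
    have h2 := hF.tailLoss_pos ⟨ha0.trans_le hab, hb.2.trans hpl'⟩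
    rw [← Real.log_le_log_iff h1 h2, hF.log_tailLoss ⟨ha0, ha.2.trans hpl'⟩,
      hF.log_tailLoss ⟨ha0.trans_le hab, hb.2.trans hpl'⟩]
    exact hF.monotoneOn_logLoss hpl hL ⟨ha0, ha.2⟩ ⟨ha0.trans_le hab, hb.2⟩ hab

/-- Below its maximal value the loss along the tail is strictly increasing. -/
lemma tailLoss_lt_tailLoss (hF : IsTypeDistribution F f) (hpl : IsLowerBound F pl)
    (hL : ConcaveOn ℝ (Ioc 0 (1 / 3)) (logLoss F)) {a b : ℝ} (ha : 0 ≤ a) (hab : a < b)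
    (hb : b ≤ pl) (h : tailLoss F a < tailLoss F pl) : tailLoss F a < tailLoss F b := by
  have hpl' := hpl.mem_Ioc.2
  have hb' := hF.tailLoss_pos ⟨ha.trans_lt hab, hb.trans hpl'⟩
  rcases ha.eq_or_lt with rfl | ha0
  · rwa [hF.tailLoss_zero]
  rcases hb.eq_or_lt with rfl | hbpl
  · exact h
  have ha' := hF.tailLoss_pos ⟨ha0, (hab.le.trans hb).trans hpl'⟩
  rw [← Real.log_lt_log_iff ha' (hF.tailLoss_pos hpl.mem_Ioc),
    hF.log_tailLoss ⟨ha0, (hab.le.trans hb).trans hpl'⟩, hF.log_tailLoss hpl.mem_Ioc] at h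
  rw [← Real.log_lt_log_iff ha' hb', hF.log_tailLoss ⟨ha0, (hab.le.trans hb).trans hpl'⟩,
    hF.log_tailLoss ⟨ha0.trans hab, hb.trans hpl'⟩]
  exact hL.lt_of_lt_right ⟨ha0, (hab.le.trans hb).trans hpl'⟩ hpl.mem_Ioc hab hbpl h

end IsTypeDistribution

end TeamSorting

/-! ### The marginal loss and its primitive -/

namespace TeamSorting

open Filter Topology

/-- The marginal loss `-m(x)` of a type, extended from `[0,1]` to the real line by constants. -/
noncomputable def marginalLoss (F : Measure ℝ) (pl x : ℝ) : ℝ :=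
  -marginalProduct F pl (projIcc (0 : ℝ) 1 zero_le_one x)

/-- The primitive of the marginal loss. Up to a constant, its negative is the wage function. -/
noncomputable def lossPotential (F : Measure ℝ) (pl x : ℝ) : ℝ :=
  ∫ t in (0 : ℝ)..x, marginalLoss F pl t

/-- The loss of a triple in excess of the potentials of its members. -/
noncomputable def reducedLoss (F : Measure ℝ) (pl x y z : ℝ) : ℝ :=
  x * y * z - lossPotential F pl x - lossPotential F pl y - lossPotential F pl z

/-- The value of the reduced loss at the end of the tail, which turns out to be its minimum. -/
noncomputable def minLoss (F : Measure ℝ) (pl : ℝ) : ℝ :=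
  reducedLoss F pl (invCdf F pl) (invCdf F (1 - 2 * pl)) (invCdf F (1 - 2 * pl))

/-- The percentile in `[0, pl]` of the tail team that has the same loss as the teams of the
percentile `p`. -/
noncomputable def foldPercentile (pl p : ℝ) : ℝ := min (min p ((1 - p) / 2)) pl

lemma marginalLoss_of_mem (F : Measure ℝ) (pl : ℝ) {x : ℝ} (hx : x ∈ Icc (0 : ℝ) 1) :
    marginalLoss F pl x = -marginalProduct F pl x := by
  rw [marginalLoss, projIcc_of_mem _ hx]

lemma foldPercentile_mem {pl p : ℝ} (hpl : 0 ≤ pl) (hp : p ∈ Icc (0 : ℝ) 1) :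
    foldPercentile pl p ∈ Icc 0 pl :=
  ⟨le_min (le_min hp.1 (by linarith [hp.2])) hpl, min_le_right _ _⟩

/-- A function whose increments are at most quadratic in those of a continuous function takes the
same value at the two ends of an interval. -/
lemma eq_of_abs_sub_le_sq {J S : ℝ → ℝ} {p q C : ℝ} (hpq : p ≤ q) (hS : ContinuousOn S (Icc p q))
    (hSpq : S p ≤ S q)
    (h : ∀ x ∈ Icc p q, ∀ y ∈ Icc p q, |J y - J x| ≤ C * (S y - S x) ^ 2) : J p = J q := by
  have hC : ∀ x : ℝ, C * x ^ 2 ≤ |C| * x ^ 2 := fun x =>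
    mul_le_mul_of_nonneg_right (le_abs_self C) (sq_nonneg x)
  have hsurj : ∀ s : Icc (S p) (S q), ∃ r ∈ Icc p q, S r = s := fun s =>
    intermediate_value_Icc hpq hS s.2
  choose r hr hrS using hsurj
  -- reparametrize by the values of `S`
  set G : ℝ → ℝ := fun s => J (r (projIcc _ _ hSpq s)) with hG
  have hGle : ∀ s t, |G t - G s| ≤ |C| * (t - s) ^ 2 := by
    intro s t
    refine ((h _ (hr _) _ (hr _)).trans (hC _)).trans ?_
    rw [hrS, hrS]
    refine mul_le_mul_of_nonneg_left ?_ (abs_nonneg C)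
    rw [sq_le_sq]
    exact abs_projIcc_sub_projIcc hSpq
  have hder : ∀ s, HasDerivAt G 0 s := by
    intro s
    have h1 : (fun t => G t - G s) =O[𝓝 s] fun t => ‖t - s‖ ^ 2 := by
      refine Asymptotics.IsBigO.of_bound |C| (Eventually.of_forall fun t => ?_)
      rw [Real.norm_eq_abs, norm_pow, norm_norm, Real.norm_eq_abs, sq_abs]
      exact hGle s t
    have h2 := (h1.hasFDerivAt (𝕜 := ℝ) one_lt_two).hasDerivAt
    simpa using h2.add_const (G s)
  have hconst := is_const_of_deriv_eq_zero (fun s => (hder s).differentiableAt)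
    (fun s => (hder s).deriv) (S p) (S q)
  have hend : ∀ x ∈ Icc p q, S x ∈ Icc (S p) (S q) → G (S x) = J x := by
    intro x hx hxS
    have h1 := h x hx _ (hr (projIcc _ _ hSpq (S x)))
    rw [hrS, projIcc_of_mem _ hxS, sub_self] at h1
    have h2 : |J (r ⟨S x, hxS⟩) - J x| ≤ 0 := by simpa using h1
    rw [hG]
    simp only [projIcc_of_mem _ hxS]
    linarith [abs_nonpos_iff.1 h2]
  rw [hend p (left_mem_Icc.2 hpq) (left_mem_Icc.2 hSpq),
    hend q (right_mem_Icc.2 hpq) (right_mem_Icc.2 hSpq)] at hconst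
  exact hconst

namespace IsTypeDistribution

variable {F : Measure ℝ} {f : ℝ → ℝ} {pl : ℝ}

lemma marginalLoss_invCdf (hF : IsTypeDistribution F f) {p : ℝ} (hp : p ∈ Icc (0 : ℝ) 1) :
    marginalLoss F pl (invCdf F p) = if p ≤ pl then invCdf F (1 - 2 * p) ^ 2
      else if p < 1 - 2 * pl then mixedLoss F pl / invCdf F p
      else invCdf F p * invCdf F ((1 - p) / 2) := by
  rw [marginalLoss_of_mem _ _ (hF.invCdf_mem hp), marginalProduct, hF.cdf_invCdf hp]
  split_ifs <;> simp

lemma marginalLoss_low (hF : IsTypeDistribution F f) (hpl : IsLowerBound F pl) {q : ℝ}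
    (hq : q ∈ Icc 0 pl) : marginalLoss F pl (invCdf F q) = invCdf F (1 - 2 * q) ^ 2 := by
  rw [hF.marginalLoss_invCdf ⟨hq.1, by linarith [hq.2, hpl.mem_Ioc.2]⟩, if_pos hq.2]

lemma marginalLoss_high (hF : IsTypeDistribution F f) (hpl : IsLowerBound F pl) {q : ℝ}
    (hq : q ∈ Icc 0 pl) :
    marginalLoss F pl (invCdf F (1 - 2 * q)) = invCdf F q * invCdf F (1 - 2 * q) := by
  have h3 := hpl.mem_Ioc.2
  rw [hF.marginalLoss_invCdf ⟨by linarith [hq.2], by linarith [hq.1]⟩]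
  split_ifs with h1 h2
  · have h4 : q = 1 / 3 := by linarith [hq.2]
    rw [h4]; norm_num [sq]
  · linarith [hq.2]
  · rw [show (1 - (1 - 2 * q)) / 2 = q by ring, mul_comm]

lemma marginalLoss_middle (hF : IsTypeDistribution F f) (hpl : IsLowerBound F pl) {p : ℝ}
    (hp : p ∈ Icc pl (1 - 2 * pl)) :
    marginalLoss F pl (invCdf F p) = tailLoss F pl / invCdf F p := by
  have h0 := hpl.mem_Ioc.1
  have hI := hF.invCdf_pos (h0.trans_le hp.1) (by linarith [hp.2])
  rcases hp.1.eq_or_lt with rfl | h1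
  · rw [hF.marginalLoss_low hpl ⟨h0.le, le_rfl⟩, tailLoss, eq_div_iff hI.ne', mul_comm]
  rcases hp.2.eq_or_lt with rfl | h2
  · rw [hF.marginalLoss_high hpl ⟨h0.le, le_rfl⟩, tailLoss, eq_div_iff hI.ne']
    ring
  · rw [hF.marginalLoss_invCdf ⟨by linarith, by linarith⟩, if_neg (not_le.2 h1), if_pos h2,
      hpl.mixedLoss_eq (by linarith)]

lemma invCdf_mul_marginalLoss (hF : IsTypeDistribution F f) (hpl : IsLowerBound F pl) {p : ℝ}
    (hp : p ∈ Icc (0 : ℝ) 1) :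
    invCdf F p * marginalLoss F pl (invCdf F p) = tailLoss F (foldPercentile pl p) := by
  have h0 := hpl.mem_Ioc
  rcases le_total p pl with h1 | h1
  · rw [hF.marginalLoss_low hpl ⟨hp.1, h1⟩, foldPercentile,
      min_eq_left (a := p) (by linarith [h0.2]), min_eq_left h1, tailLoss]
  rcases le_total p (1 - 2 * pl) with h2 | h2
  · rw [hF.marginalLoss_middle hpl ⟨h1, h2⟩, mul_div_cancel₀ _
      (hF.invCdf_pos (h0.1.trans_le h1) hp.2).ne', foldPercentile,
      min_eq_right (le_min h1 (by linarith))]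
  · obtain ⟨q, rfl⟩ : ∃ q, p = 1 - 2 * q := ⟨(1 - p) / 2, by ring⟩
    have hq : q ∈ Icc 0 pl := ⟨by linarith [hp.2], by linarith⟩
    rw [hF.marginalLoss_high hpl hq, foldPercentile, show (1 - (1 - 2 * q)) / 2 = q by ring,
      min_eq_right (a := 1 - 2 * q) (by linarith [hq.2, h0.2]), min_eq_left hq.2, tailLoss]
    ring

lemma mul_marginalLoss (hF : IsTypeDistribution F f) (hpl : IsLowerBound F pl) {x : ℝ}
    (hx : x ∈ Icc (0 : ℝ) 1) :
    x * marginalLoss F pl x = tailLoss F (foldPercentile pl (cdf F x)) := by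
  have := hF.invCdf_mul_marginalLoss hpl (cdf_mem_Icc F x)
  rwa [hF.invCdf_cdf hx] at this

lemma marginalLoss_zero (hF : IsTypeDistribution F f) (hpl : IsLowerBound F pl) :
    marginalLoss F pl 0 = 1 := by
  have := hF.marginalLoss_low hpl (q := 0) ⟨le_rfl, hpl.mem_Ioc.1.le⟩
  rwa [hF.invCdf_zero, mul_zero, sub_zero, hF.invCdf_one, one_pow] at this

lemma marginalLoss_one (hF : IsTypeDistribution F f) (hpl : IsLowerBound F pl) :
    marginalLoss F pl 1 = 0 := by
  have := hF.marginalLoss_high hpl (q := 0) ⟨le_rfl, hpl.mem_Ioc.1.le⟩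
  rwa [hF.invCdf_zero, mul_zero, sub_zero, hF.invCdf_one, zero_mul] at this

lemma continuousOn_marginalProduct (hF : IsTypeDistribution F f) (hpl : IsLowerBound F pl) :
    ContinuousOn (marginalProduct F pl) (Icc 0 1) := by
  have h0 := hpl.mem_Ioc
  have hneg : ContinuousOn (fun x => marginalLoss F pl x) (Icc 0 1) := by
    intro x hx
    rcases hx.1.eq_or_lt with rfl | hx0
    · have h1 : ContinuousWithinAt (fun x => invCdf F (1 - 2 * cdf F x) ^ 2)
          (Icc 0 1 ∩ {x | cdf F x < pl}) 0 := by
        refine ContinuousOn.pow ?_ 2 0 ⟨hx, by simpa [hF.cdf_zero] using h0.1⟩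
        refine hF.continuousOn_invCdf_one_sub.comp hF.continuous_cdf.continuousOn ?_
        exact fun y hy => ⟨cdf_nonneg F y, (le_of_lt hy.2).trans h0.2⟩
      have h2 : Icc (0 : ℝ) 1 ∩ {x | cdf F x < pl} ∈ 𝓝[Icc 0 1] (0 : ℝ) := by
        refine inter_mem self_mem_nhdsWithin (mem_nhdsWithin_of_mem_nhds ?_)
        exact (isOpen_lt hF.continuous_cdf continuous_const).mem_nhds
          (by simpa [hF.cdf_zero] using h0.1)
      refine (h1.congr (fun y hy => ?_) ?_).mono_of_mem_nhdsWithin h2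
      · have := hF.marginalLoss_low hpl ⟨cdf_nonneg F y, le_of_lt hy.2⟩
        rwa [hF.invCdf_cdf hy.1] at this
      · rw [hF.marginalLoss_zero hpl, hF.cdf_zero, mul_zero, sub_zero, hF.invCdf_one, one_pow]
    · have h1 : ContinuousOn (fun x => tailLoss F (foldPercentile pl (cdf F x)) / x) (Ioc 0 1) := by
        refine ContinuousOn.div ?_ continuousOn_id fun y hy => hy.1.ne'
        refine hF.continuousOn_tailLoss.comp (Continuous.continuousOn ?_) ?_
        · have := hF.continuous_cdf
          unfold foldPercentile
          fun_prop
        · intro y _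
          have := foldPercentile_mem h0.1.le (cdf_mem_Icc F y)
          exact ⟨this.1, this.2.trans h0.2⟩
      have h2 : ContinuousOn (fun x => marginalLoss F pl x) (Ioc 0 1) := by
        refine h1.congr fun y hy => ?_
        rw [eq_div_iff hy.1.ne', mul_comm, hF.mul_marginalLoss hpl ⟨hy.1.le, hy.2⟩]
      refine (h2 x ⟨hx0, hx.2⟩).mono_of_mem_nhdsWithin ?_
      filter_upwards [self_mem_nhdsWithin, mem_nhdsWithin_of_mem_nhds (Ioi_mem_nhds hx0)]
        with y hy hy0 using ⟨hy0, hy.2⟩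
  refine hneg.neg.congr fun x hx => ?_
  simp [marginalLoss_of_mem F pl hx]

lemma continuous_marginalLoss (hF : IsTypeDistribution F f) (hpl : IsLowerBound F pl) :
    Continuous (marginalLoss F pl) := by
  have h := (continuousOn_iff_continuous_domRestrict.1 (hF.continuousOn_marginalProduct hpl))
  exact (h.comp continuous_projIcc).neg

lemma hasDerivAt_lossPotential (hF : IsTypeDistribution F f) (hpl : IsLowerBound F pl) (x : ℝ) :
    HasDerivAt (lossPotential F pl) (marginalLoss F pl x) x :=
  intervalIntegral.integral_hasDerivAt_right
    ((hF.continuous_marginalLoss hpl).intervalIntegrable _ _)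
    ((hF.continuous_marginalLoss hpl).stronglyMeasurableAtFilter _ _)
    (hF.continuous_marginalLoss hpl).continuousAt

lemma continuous_lossPotential (hF : IsTypeDistribution F f) (hpl : IsLowerBound F pl) :
    Continuous (lossPotential F pl) :=
  continuous_iff_continuousAt.2 fun x => (hF.hasDerivAt_lossPotential hpl x).continuousAt

lemma exists_lossPotential_sub_eq (hF : IsTypeDistribution F f) (hpl : IsLowerBound F pl)
    {x y : ℝ} (hxy : x ≤ y) : ∃ c ∈ Icc x y,
      lossPotential F pl y - lossPotential F pl x = marginalLoss F pl c * (y - x) := by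
  rcases hxy.eq_or_lt with rfl | hlt
  · exact ⟨x, by simp, by simp⟩
  · obtain ⟨c, hc, h⟩ := exists_hasDerivAt_eq_slope (lossPotential F pl) (marginalLoss F pl) hlt
      (hF.continuous_lossPotential hpl).continuousOn
      fun t _ => hF.hasDerivAt_lossPotential hpl t
    refine ⟨c, Ioo_subset_Icc_self hc, ?_⟩
    rw [h, div_mul_cancel₀]
    linarith

/-- The reduced loss is constant along the tail. No differentiability of the inverse distribution
function is available; instead, the first-order conditions make the increments quadratic in those
of `I(q) - I(1 - 2q)`. -/
lemma reducedLoss_tail (hF : IsTypeDistribution F f) (hpl : IsLowerBound F pl) {q : ℝ}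
    (hq : q ∈ Icc 0 pl) :
    reducedLoss F pl (invCdf F q) (invCdf F (1 - 2 * q)) (invCdf F (1 - 2 * q)) =
      minLoss F pl := by
  have h0 := hpl.mem_Ioc
  have hmono := hF.strictMonoOn_invCdf.monotoneOn
  have hm1 : ∀ r ∈ Icc 0 pl, r ∈ Icc (0 : ℝ) 1 := fun r hr => ⟨hr.1, by linarith [hr.2, h0.2]⟩
  have hm2 : ∀ r ∈ Icc 0 pl, 1 - 2 * r ∈ Icc (0 : ℝ) 1 := fun r hr =>
    ⟨by linarith [hr.2, h0.2], by linarith [hr.1]⟩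
  set J : ℝ → ℝ := fun q =>
    reducedLoss F pl (invCdf F q) (invCdf F (1 - 2 * q)) (invCdf F (1 - 2 * q)) with hJ
  set S : ℝ → ℝ := fun q => invCdf F q - invCdf F (1 - 2 * q) with hS
  have key : ∀ x ∈ Icc 0 pl, ∀ y ∈ Icc 0 pl, x ≤ y → |J y - J x| ≤ 4 * (S y - S x) ^ 2 := by
    intro x hx y hy hxy
    have ha : invCdf F x ≤ invCdf F y := hmono (hm1 x hx) (hm1 y hy) hxy
    have hb : invCdf F (1 - 2 * y) ≤ invCdf F (1 - 2 * x) :=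
      hmono (hm2 y hy) (hm2 x hx) (by linarith)
    obtain ⟨c₁, hc₁, e₁⟩ := hF.exists_lossPotential_sub_eq hpl ha
    obtain ⟨c₂, hc₂, e₂⟩ := hF.exists_lossPotential_sub_eq hpl hb
    have hc₁m : c₁ ∈ Icc (0 : ℝ) 1 := ⟨(hF.invCdf_mem (hm1 x hx)).1.trans hc₁.1,
      hc₁.2.trans (hF.invCdf_mem (hm1 y hy)).2⟩
    have hc₂m : c₂ ∈ Icc (0 : ℝ) 1 := ⟨(hF.invCdf_mem (hm2 y hy)).1.trans hc₂.1,
      hc₂.2.trans (hF.invCdf_mem (hm2 x hx)).2⟩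
    -- the intermediate points are themselves members of tail teams
    obtain ⟨r, hr, rfl⟩ : ∃ r ∈ Icc x y, invCdf F r = c₁ := by
      refine ⟨cdf F c₁, ⟨?_, ?_⟩, hF.invCdf_cdf hc₁m⟩
      · rw [← hF.cdf_invCdf (hm1 x hx)]; exact monotone_cdf F hc₁.1
      · rw [← hF.cdf_invCdf (hm1 y hy)]; exact monotone_cdf F hc₁.2
    obtain ⟨t, ht, rfl⟩ : ∃ t ∈ Icc x y, invCdf F (1 - 2 * t) = c₂ := by
      have h1 := monotone_cdf F hc₂.1
      have h2 := monotone_cdf F hc₂.2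
      rw [hF.cdf_invCdf (hm2 y hy)] at h1
      rw [hF.cdf_invCdf (hm2 x hx)] at h2
      refine ⟨(1 - cdf F c₂) / 2, ⟨by linarith, by linarith⟩, ?_⟩
      rw [show 1 - 2 * ((1 - cdf F c₂) / 2) = cdf F c₂ by ring, hF.invCdf_cdf hc₂m]
    have hr' : r ∈ Icc 0 pl := ⟨hx.1.trans hr.1, hr.2.trans hy.2⟩
    have ht' : t ∈ Icc 0 pl := ⟨hx.1.trans ht.1, ht.2.trans hy.2⟩
    rw [hF.marginalLoss_low hpl hr'] at e₁
    rw [hF.marginalLoss_high hpl ht'] at e₂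
    have hβ1 : invCdf F (1 - 2 * y) ≤ invCdf F (1 - 2 * r) :=
      hmono (hm2 y hy) (hm2 r hr') (by linarith [hr.2])
    have hβ2 : invCdf F (1 - 2 * r) ≤ invCdf F (1 - 2 * x) :=
      hmono (hm2 r hr') (hm2 x hx) (by linarith [hr.1])
    have hα1 : invCdf F x ≤ invCdf F t := hmono (hm1 x hx) (hm1 t ht') ht.1
    have hα2 : invCdf F t ≤ invCdf F y := hmono (hm1 t ht') (hm1 y hy) ht.2
    simp only [hJ, hS, reducedLoss]
    have ma := hF.invCdf_mem (hm1 x hx)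
    have mb := hF.invCdf_mem (hm2 x hx)
    have ma' := hF.invCdf_mem (hm1 y hy)
    have mb' := hF.invCdf_mem (hm2 y hy)
    generalize invCdf F x = a at *
    generalize invCdf F y = a' at *
    generalize invCdf F (1 - 2 * x) = b at *
    generalize invCdf F (1 - 2 * y) = b' at *
    generalize invCdf F (1 - 2 * r) = β at *
    generalize invCdf F t = α at *
    generalize invCdf F (1 - 2 * t) = γ at *
    have hd₁ : 0 ≤ a' - a := by linarith
    have hd₂ : 0 ≤ b - b' := by linarith
    have hE : a' * b' * b' - lossPotential F pl a' - lossPotential F pl b' - lossPotential F pl b' -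
        (a * b * b - lossPotential F pl a - lossPotential F pl b - lossPotential F pl b) =
        (a' - a) * (b' ^ 2 - β ^ 2) + (b - b') * (2 * (α * γ) - a * (b + b')) := by
      linear_combination -e₁ + 2 * e₂
    have hu1 : b' ^ 2 - β ^ 2 ≤ 0 := by nlinarith [mb'.1]
    have hu2 : -(2 * (b - b')) ≤ b' ^ 2 - β ^ 2 := by nlinarith [mb'.1, mb.2]
    have hv1 : 2 * (α * γ) - a * (b + b') ≤ 2 * (a' - a) + (b - b') := by
      have h1 : α * γ ≤ a' * b := mul_le_mul hα2 hc₂.2 (mb'.1.trans hc₂.1) ma'.1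
      nlinarith [mul_nonneg hd₁ (sub_nonneg.2 mb.2), mul_nonneg hd₂ (sub_nonneg.2 ma.2)]
    have hv2 : -(b - b') ≤ 2 * (α * γ) - a * (b + b') := by
      have h1 : a * b' ≤ α * γ := mul_le_mul hα1 hc₂.1 mb'.1 (ma.1.trans hα1)
      nlinarith [mul_nonneg hd₂ (sub_nonneg.2 ma.2)]
    rw [hE, show a' - b' - (a - b) = (a' - a) + (b - b') by ring, abs_le]
    generalize a' - a = d₁ at hd₁ hv1 ⊢
    generalize b - b' = d₂ at hd₁ hd₂ hu2 hv1 hv2 ⊢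
    constructor
    · linarith [mul_le_mul_of_nonneg_left hu2 hd₁, mul_le_mul_of_nonneg_left hv2 hd₂,
        mul_nonneg hd₁ hd₂, sq_nonneg d₁, sq_nonneg d₂, add_sq d₁ d₂, sq d₂]
    · linarith [mul_le_mul_of_nonneg_left hu1 hd₁, mul_le_mul_of_nonneg_left hv1 hd₂,
        mul_nonneg hd₁ hd₂, sq_nonneg d₁, sq_nonneg d₂, add_sq d₁ d₂, sq d₂]
  have hcont : ContinuousOn S (Icc q pl) :=
    ContinuousOn.mono ((hF.continuousOn_invCdf.mono hm1).sub
      (hF.continuousOn_invCdf_one_sub.mono fun r hr => ⟨hr.1, hr.2.trans h0.2⟩))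
      (Icc_subset_Icc_left hq.1)
  have hpl' : pl ∈ Icc 0 pl := right_mem_Icc.2 h0.1.le
  refine eq_of_abs_sub_le_sq (J := J) (S := S) (C := 4) hq.2 hcont ?_ fun x hx y hy => ?_
  · have h1 := hmono (hm1 q hq) (hm1 pl hpl') hq.2
    have h2 := hmono (hm2 pl hpl') (hm2 q hq) (by linarith [hq.2])
    simp only [hS]
    linarith
  · have hx' : x ∈ Icc 0 pl := ⟨hq.1.trans hx.1, hx.2⟩
    have hy' : y ∈ Icc 0 pl := ⟨hq.1.trans hy.1, hy.2⟩
    rcases le_total x y with h | h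
    · exact key x hx' y hy' h
    · rw [abs_sub_comm, show (S y - S x) ^ 2 = (S x - S y) ^ 2 by ring]
      exact key y hy' x hx' h

end IsTypeDistribution

end TeamSorting

/-! ### The minimum of the reduced loss -/

namespace TeamSorting

open Filter Topology

lemma reducedLoss_swap (F : Measure ℝ) (pl x y z : ℝ) :
    reducedLoss F pl x y z = reducedLoss F pl y x z := by
  unfold reducedLoss; ring

lemma reducedLoss_rotate (F : Measure ℝ) (pl x y z : ℝ) :
    reducedLoss F pl x y z = reducedLoss F pl y z x := by
  unfold reducedLoss; ring

/-- First-order condition for a minimum over the unit interval, as a variational inequality. -/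
lemma mul_deriv_nonneg_of_isMinOn {h : ℝ → ℝ} {d x : ℝ} (hd : HasDerivAt h d x)
    (hx : x ∈ Icc (0 : ℝ) 1) (hmin : ∀ x' ∈ Icc (0 : ℝ) 1, h x ≤ h x') {x' : ℝ}
    (hx' : x' ∈ Icc (0 : ℝ) 1) : 0 ≤ (x' - x) * d := by
  have h1 : IsLocalMinOn h (Icc 0 1) x := by
    filter_upwards [self_mem_nhdsWithin] with y hy using hmin y hy
  have h2 := h1.hasFDerivWithinAt_nonneg hd.hasFDerivAt.hasFDerivWithinAt
    (sub_mem_posTangentConeAt_of_segment_subset ((convex_Icc (0 : ℝ) 1).segment_subset hx hx'))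
  simpa using h2

namespace IsTypeDistribution

variable {F : Measure ℝ} {f : ℝ → ℝ} {pl : ℝ}

lemma mul_sub_marginalLoss_nonneg (hF : IsTypeDistribution F f) (hpl : IsLowerBound F pl)
    {x y z : ℝ} (hx : x ∈ Icc (0 : ℝ) 1)
    (hmin : ∀ x' ∈ Icc (0 : ℝ) 1, reducedLoss F pl x y z ≤ reducedLoss F pl x' y z) {x' : ℝ}
    (hx' : x' ∈ Icc (0 : ℝ) 1) : 0 ≤ (x' - x) * (y * z - marginalLoss F pl x) := by
  refine mul_deriv_nonneg_of_isMinOn (h := fun x => reducedLoss F pl x y z) ?_ hx hmin hx'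
  have h1 : HasDerivAt (fun x : ℝ => x * y * z) (y * z) x := by
    simpa using ((hasDerivAt_id x).mul_const y).mul_const z
  exact ((h1.sub (hF.hasDerivAt_lossPotential hpl x)).sub_const _).sub_const _

lemma mul_eq_marginalLoss (hF : IsTypeDistribution F f) (hpl : IsLowerBound F pl)
    {x y z : ℝ} (hx : x ∈ Ioo (0 : ℝ) 1)
    (hmin : ∀ x' ∈ Icc (0 : ℝ) 1, reducedLoss F pl x y z ≤ reducedLoss F pl x' y z) :
    y * z = marginalLoss F pl x := by
  have h0 := hF.mul_sub_marginalLoss_nonneg hpl ⟨hx.1.le, hx.2.le⟩ hmin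
    (left_mem_Icc.2 zero_le_one)
  have h1 := hF.mul_sub_marginalLoss_nonneg hpl ⟨hx.1.le, hx.2.le⟩ hmin
    (right_mem_Icc.2 zero_le_one)
  have h2 := nonneg_of_mul_nonneg_right h1 (by linarith [hx.2])
  have h3 := nonpos_of_mul_nonneg_right h0 (by linarith [hx.1])
  linarith

/-- Where the loss `C / x` is the marginal loss, the potential is `C log x` up to a constant, so
that the reduced loss depends on a triple only through its product. -/
lemma reducedLoss_eq_of_mul_eq (hF : IsTypeDistribution F f) (hpl : IsLowerBound F pl)
    {lo hi C : ℝ} (hlo : 0 < lo) (hg : ∀ t ∈ Icc lo hi, t * marginalLoss F pl t = C)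
    {x y z x' y' z' : ℝ} (hx : x ∈ Icc lo hi) (hy : y ∈ Icc lo hi) (hz : z ∈ Icc lo hi)
    (hx' : x' ∈ Icc lo hi) (hy' : y' ∈ Icc lo hi) (hz' : z' ∈ Icc lo hi)
    (h : x * y * z = x' * y' * z') : reducedLoss F pl x y z = reducedLoss F pl x' y' z' := by
  have hconst : ∀ t ∈ Icc lo hi, lossPotential F pl t - C * Real.log t =
      lossPotential F pl lo - C * Real.log lo := by
    have hder : ∀ t ∈ Icc lo hi,
        HasDerivAt (fun t => lossPotential F pl t - C * Real.log t) 0 t := by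
      intro t ht
      have ht0 : t ≠ 0 := (hlo.trans_le ht.1).ne'
      have h1 := (hF.hasDerivAt_lossPotential hpl t).sub ((Real.hasDerivAt_log ht0).const_mul C)
      have h2 : marginalLoss F pl t - C * t⁻¹ = 0 := by
        rw [← hg t ht]; field_simp; ring
      rwa [h2] at h1
    exact constant_of_has_deriv_right_zero
      (fun t ht => (hder t ht).continuousAt.continuousWithinAt)
      fun t ht => (hder t ⟨ht.1, ht.2.le⟩).hasDerivWithinAt
  have hpos : ∀ t ∈ Icc lo hi, t ≠ 0 := fun t ht => (hlo.trans_le ht.1).ne'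
  have hlog := congrArg Real.log h
  rw [Real.log_mul (mul_ne_zero (hpos x hx) (hpos y hy)) (hpos z hz),
    Real.log_mul (hpos x hx) (hpos y hy),
    Real.log_mul (mul_ne_zero (hpos x' hx') (hpos y' hy')) (hpos z' hz'),
    Real.log_mul (hpos x' hx') (hpos y' hy')] at hlog
  unfold reducedLoss
  linear_combination h - hconst x hx - hconst y hy - hconst z hz + hconst x' hx' + hconst y' hy'
    + hconst z' hz' - C * hlog

/-- Triples of constant loss `C = tailLoss F pl` on the range of types where the loss of teams is
maximal have the same reduced loss as the end of the tail. -/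
lemma reducedLoss_middle (hF : IsTypeDistribution F f) (hpl : IsLowerBound F pl)
    (hL : ConcaveOn ℝ (Ioc 0 (1 / 3)) (logLoss F)) {q : ℝ} (hq : q ∈ Ioc 0 pl)
    (hqC : tailLoss F q = tailLoss F pl) {x y z : ℝ}
    (hx : x ∈ Icc (invCdf F q) (invCdf F (1 - 2 * q)))
    (hy : y ∈ Icc (invCdf F q) (invCdf F (1 - 2 * q)))
    (hz : z ∈ Icc (invCdf F q) (invCdf F (1 - 2 * q)))
    (h : x * y * z = tailLoss F pl) : reducedLoss F pl x y z = minLoss F pl := by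
  have h0 := hpl.mem_Ioc
  have hq1 : q ∈ Icc (0 : ℝ) 1 := ⟨hq.1.le, by linarith [hq.2, h0.2]⟩
  have hq2 : 1 - 2 * q ∈ Icc (0 : ℝ) 1 := ⟨by linarith [hq.2, h0.2], by linarith [hq.1]⟩
  have hpl1 : pl ∈ Icc (0 : ℝ) 1 := ⟨h0.1.le, by linarith [h0.2]⟩
  have hpl2 : 1 - 2 * pl ∈ Icc (0 : ℝ) 1 := ⟨by linarith [h0.2], by linarith [h0.1]⟩
  have hmono := hF.strictMonoOn_invCdf.monotoneOn
  have hg : ∀ t ∈ Icc (invCdf F q) (invCdf F (1 - 2 * q)),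
      t * marginalLoss F pl t = tailLoss F pl := by
    intro t ht
    have ht1 : t ∈ Icc (0 : ℝ) 1 :=
      ⟨(hF.invCdf_mem hq1).1.trans ht.1, ht.2.trans (hF.invCdf_mem hq2).2⟩
    have h1 := monotone_cdf F ht.1
    have h2 := monotone_cdf F ht.2
    rw [hF.cdf_invCdf hq1] at h1
    rw [hF.cdf_invCdf hq2] at h2
    rw [hF.mul_marginalLoss hpl ht1]
    have h3 : q ≤ foldPercentile pl (cdf F t) := le_min (le_min h1 (by linarith)) hq.2
    have h4 := foldPercentile_mem h0.1.le (cdf_mem_Icc F t)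
    refine le_antisymm ?_ ?_
    · exact hF.monotoneOn_tailLoss hpl hL h4 ⟨h0.1.le, le_rfl⟩ h4.2
    · rw [← hqC]
      exact hF.monotoneOn_tailLoss hpl hL ⟨hq.1.le, hq.2⟩ h4 h3
  have e1 : invCdf F pl ∈ Icc (invCdf F q) (invCdf F (1 - 2 * q)) :=
    ⟨hmono hq1 hpl1 hq.2, hmono hpl1 hq2 (by linarith [hq.2, h0.2])⟩
  have e2 : invCdf F (1 - 2 * pl) ∈ Icc (invCdf F q) (invCdf F (1 - 2 * q)) :=
    ⟨hmono hq1 hpl2 (by linarith [hq.2, h0.2]), hmono hpl2 hq2 (by linarith [hq.2])⟩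
  refine hF.reducedLoss_eq_of_mul_eq hpl (hF.invCdf_pos hq.1 hq1.2) hg hx hy hz e1 e2 e2 ?_
  rw [h, tailLoss]; ring

/-- Triples that satisfy the first-order conditions in the interior have the minimal reduced
loss. -/
lemma reducedLoss_eq_of_critical (hF : IsTypeDistribution F f) (hpl : IsLowerBound F pl)
    (hL : ConcaveOn ℝ (Ioc 0 (1 / 3)) (logLoss F)) {x y z : ℝ} (hx : x ∈ Ioo (0 : ℝ) 1)
    (hy : y ∈ Ioo (0 : ℝ) 1) (hz : z ∈ Ioo (0 : ℝ) 1) (h1 : y * z = marginalLoss F pl x)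
    (h2 : z * x = marginalLoss F pl y) (h3 : x * y = marginalLoss F pl z) :
    reducedLoss F pl x y z = minLoss F pl := by
  have h0 := hpl.mem_Ioc
  have hmono := hF.strictMonoOn_invCdf.monotoneOn
  have hx' := Ioo_subset_Icc_self hx
  have hy' := Ioo_subset_Icc_self hy
  have hz' := Ioo_subset_Icc_self hz
  have e1 : tailLoss F (foldPercentile pl (cdf F x)) = x * y * z := by
    rw [← hF.mul_marginalLoss hpl hx', ← h1]; ring
  have e2 : tailLoss F (foldPercentile pl (cdf F y)) = x * y * z := by
    rw [← hF.mul_marginalLoss hpl hy', ← h2]; ring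
  have e3 : tailLoss F (foldPercentile pl (cdf F z)) = x * y * z := by
    rw [← hF.mul_marginalLoss hpl hz', ← h3]; ring
  have m1 := foldPercentile_mem h0.1.le (cdf_mem_Icc F x)
  have m2 := foldPercentile_mem h0.1.le (cdf_mem_Icc F y)
  have m3 := foldPercentile_mem h0.1.le (cdf_mem_Icc F z)
  have hle : x * y * z ≤ tailLoss F pl := by
    rw [← e1]; exact hF.monotoneOn_tailLoss hpl hL m1 ⟨h0.1.le, le_rfl⟩ m1.2
  have hcdf_pos : ∀ t ∈ Ioo (0 : ℝ) 1, 0 < cdf F t ∧ cdf F t < 1 := by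
    intro t ht
    have h4 := hF.strictMonoOn_cdf (left_mem_Icc.2 zero_le_one) (Ioo_subset_Icc_self ht) ht.1
    have h5 := hF.strictMonoOn_cdf (Ioo_subset_Icc_self ht) (right_mem_Icc.2 zero_le_one) ht.2
    rw [hF.cdf_zero] at h4
    rw [hF.cdf_one] at h5
    exact ⟨h4, h5⟩
  have hfold_pos : ∀ t ∈ Ioo (0 : ℝ) 1, 0 < foldPercentile pl (cdf F t) := fun t ht =>
    lt_min (lt_min (hcdf_pos t ht).1 (by linarith [(hcdf_pos t ht).2])) h0.1
  rcases hle.lt_or_eq with hlt | heq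
  · -- below the maximal loss all three members belong to the same tail team
    have huniq : ∀ a ∈ Icc 0 pl, ∀ b ∈ Icc 0 pl, tailLoss F a = x * y * z →
        tailLoss F b = x * y * z → a = b := by
      intro a ha b hb hae hbe
      rcases lt_trichotomy a b with h | h | h
      · have := hF.tailLoss_lt_tailLoss hpl hL ha.1 h hb.2 (by rwa [hae])
        linarith
      · exact h
      · have := hF.tailLoss_lt_tailLoss hpl hL hb.1 h ha.2 (by rwa [hbe])
        linarith
    obtain ⟨q, hq⟩ : ∃ q, q = foldPercentile pl (cdf F x) := ⟨_, rfl⟩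
    have q2 := huniq _ m2 _ m1 e2 e1
    have q3 := huniq _ m3 _ m1 e3 e1
    rw [← hq] at q2 q3 m1 e1
    have hqpl : q < pl := by
      refine lt_of_le_of_ne m1.2 ?_
      rintro rfl
      linarith
    have hq0 : 0 < q := hq ▸ hfold_pos x hx
    have hcases : ∀ t ∈ Icc (0 : ℝ) 1, foldPercentile pl (cdf F t) = q →
        t = invCdf F q ∨ t = invCdf F (1 - 2 * q) := by
      intro t ht hfold
      have h4 : min (cdf F t) ((1 - cdf F t) / 2) = q := by
        rw [foldPercentile] at hfold
        rcases min_choice (min (cdf F t) ((1 - cdf F t) / 2)) pl with h | h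
        · rwa [h] at hfold
        · rw [h] at hfold; linarith
      rcases min_choice (cdf F t) ((1 - cdf F t) / 2) with h | h
      · left; rw [← h4, h, hF.invCdf_cdf ht]
      · right; rw [← h4, h, show 1 - 2 * ((1 - cdf F t) / 2) = cdf F t by ring, hF.invCdf_cdf ht]
    have hab : invCdf F q < invCdf F (1 - 2 * q) :=
      hF.strictMonoOn_invCdf ⟨hq0.le, by linarith [h0.2]⟩ ⟨by linarith [h0.2], by linarith⟩
        (by linarith [h0.2])
    have ha0 : 0 < invCdf F q := hF.invCdf_pos hq0 (by linarith [h0.2])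
    have htail := hF.reducedLoss_tail hpl m1
    rw [tailLoss] at e1
    have cx := hcases x hx' hq.symm
    have cy := hcases y hy' q2
    have cz := hcases z hz' q3
    generalize invCdf F q = a at *
    generalize invCdf F (1 - 2 * q) = b at *
    have hb0 : 0 < b := ha0.trans hab
    have hab2 : a * a < a * b := mul_lt_mul_of_pos_left hab ha0
    have hab3 : a * b < b * b := mul_lt_mul_of_pos_right hab hb0
    rcases cx with rfl | rfl <;> rcases cy with rfl | rfl <;> rcases cz with rfl | rfl
    · nlinarith
    · nlinarith
    · nlinarith
    · exact htail
    · nlinarith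
    · rw [reducedLoss_swap]; exact htail
    · rw [reducedLoss_rotate, reducedLoss_rotate]; exact htail
    · nlinarith
  · -- at the maximal loss all three members belong to the range of constant loss
    obtain ⟨q, hq, hq1, hq2, hq3, hqC⟩ : ∃ q ∈ Ioc 0 pl, q ≤ foldPercentile pl (cdf F x) ∧
        q ≤ foldPercentile pl (cdf F y) ∧ q ≤ foldPercentile pl (cdf F z) ∧
        tailLoss F q = tailLoss F pl := by
      rcases min_choice (foldPercentile pl (cdf F x))
        (min (foldPercentile pl (cdf F y)) (foldPercentile pl (cdf F z))) with h | h
      · rw [min_eq_left_iff, le_min_iff] at h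
        exact ⟨_, ⟨hfold_pos x hx, m1.2⟩, le_rfl, h.1, h.2, e1.trans heq⟩
      · have h' := min_eq_right_iff.1 h
        rcases le_total (foldPercentile pl (cdf F y)) (foldPercentile pl (cdf F z)) with h4 | h4
        · rw [min_eq_left h4] at h'
          exact ⟨_, ⟨hfold_pos y hy, m2.2⟩, h', le_rfl, h4, e2.trans heq⟩
        · rw [min_eq_right h4] at h'
          exact ⟨_, ⟨hfold_pos z hz, m3.2⟩, h', h4, le_rfl, e3.trans heq⟩
    have hmem : ∀ t ∈ Icc (0 : ℝ) 1, q ≤ foldPercentile pl (cdf F t) →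
        t ∈ Icc (invCdf F q) (invCdf F (1 - 2 * q)) := by
      intro t ht hle
      have h4 := hle.trans (min_le_left _ _)
      have h5 := h4.trans (min_le_left _ _)
      have h6 := h4.trans (min_le_right _ _)
      have h7 := hmono ⟨hq.1.le, by linarith [hq.2, h0.2]⟩ (cdf_mem_Icc F t) h5
      have h8 := hmono (cdf_mem_Icc F t) ⟨by linarith [hq.2, h0.2], by linarith [hq.1]⟩
        (by linarith : cdf F t ≤ 1 - 2 * q)
      rw [hF.invCdf_cdf ht] at h7 h8
      exact ⟨h7, h8⟩
    exact hF.reducedLoss_middle hpl hL hq hqC (hmem x hx' hq1) (hmem y hy' hq2) (hmem z hz' hq3)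
      heq

/-- The reduced loss is minimal along the tail. -/
theorem minLoss_le_reducedLoss (hF : IsTypeDistribution F f) (hpl : IsLowerBound F pl)
    (hL : ConcaveOn ℝ (Ioc 0 (1 / 3)) (logLoss F)) {x y z : ℝ} (hx : x ∈ Icc (0 : ℝ) 1)
    (hy : y ∈ Icc (0 : ℝ) 1) (hz : z ∈ Icc (0 : ℝ) 1) :
    minLoss F pl ≤ reducedLoss F pl x y z := by
  have hcont := hF.continuous_lossPotential hpl
  have hcomp : IsCompact (Icc (0 : ℝ) 1 ×ˢ Icc (0 : ℝ) 1 ×ˢ Icc (0 : ℝ) 1) :=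
    isCompact_Icc.prod (isCompact_Icc.prod isCompact_Icc)
  obtain ⟨⟨a, b, c⟩, ⟨ha, hb, hc⟩, hmin⟩ := hcomp.exists_isMinOn
    ⟨(x, y, z), hx, hy, hz⟩
    (f := fun t : ℝ × ℝ × ℝ => reducedLoss F pl t.1 t.2.1 t.2.2)
    (by unfold reducedLoss; fun_prop)
  have hmin' : ∀ a' ∈ Icc (0 : ℝ) 1, ∀ b' ∈ Icc (0 : ℝ) 1, ∀ c' ∈ Icc (0 : ℝ) 1,
      reducedLoss F pl a b c ≤ reducedLoss F pl a' b' c' := fun a' h1 b' h2 c' h3 =>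
    hmin (show (a', b', c') ∈ _ from ⟨h1, h2, h3⟩)
  suffices h : reducedLoss F pl a b c = minLoss F pl by
    rw [← h]; exact hmin' x hx y hy z hz
  have hmina : ∀ a' ∈ Icc (0 : ℝ) 1, reducedLoss F pl a b c ≤ reducedLoss F pl a' b c :=
    fun a' h => hmin' a' h b hb c hc
  have hminb : ∀ b' ∈ Icc (0 : ℝ) 1, reducedLoss F pl b c a ≤ reducedLoss F pl b' c a :=
    fun b' h => by
      rw [← reducedLoss_rotate F pl a b c, ← reducedLoss_rotate F pl a b' c]
      exact hmin' a ha b' h c hc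
  have hminc : ∀ c' ∈ Icc (0 : ℝ) 1, reducedLoss F pl c a b ≤ reducedLoss F pl c' a b :=
    fun c' h => by
      rw [reducedLoss_rotate, reducedLoss_rotate _ _ c']; exact hmin' a ha b hb c' h
  -- a member at `0` has partners at `1`, and this is the beginning of the tail
  have hzero : ∀ b c : ℝ, b ∈ Icc (0 : ℝ) 1 → c ∈ Icc (0 : ℝ) 1 →
      (∀ a' ∈ Icc (0 : ℝ) 1, reducedLoss F pl 0 b c ≤ reducedLoss F pl a' b c) →
      reducedLoss F pl 0 b c = minLoss F pl := by
    intro b c hb hc h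
    have h1 := hF.mul_sub_marginalLoss_nonneg hpl (left_mem_Icc.2 zero_le_one) h
      (right_mem_Icc.2 zero_le_one)
    rw [hF.marginalLoss_zero hpl] at h1
    have h2 : b = 1 := by nlinarith [hb.1, hb.2, hc.1, hc.2]
    have h3 : c = 1 := by nlinarith [hb.1, hb.2, hc.1, hc.2]
    have h4 := hF.reducedLoss_tail hpl (left_mem_Icc.2 hpl.mem_Ioc.1.le)
    rw [hF.invCdf_zero, mul_zero, sub_zero, hF.invCdf_one] at h4
    rw [h2, h3, h4]
  have hone : ∀ b c : ℝ, b ∈ Icc (0 : ℝ) 1 → c ∈ Icc (0 : ℝ) 1 →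
      (∀ a' ∈ Icc (0 : ℝ) 1, reducedLoss F pl 1 b c ≤ reducedLoss F pl a' b c) →
      b = 0 ∨ c = 0 := by
    intro b c hb hc h
    have h1 := hF.mul_sub_marginalLoss_nonneg hpl (right_mem_Icc.2 zero_le_one) h
      (left_mem_Icc.2 zero_le_one)
    rw [hF.marginalLoss_one hpl] at h1
    have h2 : b * c = 0 := le_antisymm (by linarith) (mul_nonneg hb.1 hc.1)
    exact mul_eq_zero.1 h2
  by_cases a0 : a = 0
  · subst a0; exact hzero b c hb hc hmina
  by_cases b0 : b = 0
  · subst b0; rw [reducedLoss_rotate]; exact hzero c a hc ha hminb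
  by_cases c0 : c = 0
  · subst c0; rw [reducedLoss_rotate, reducedLoss_rotate]; exact hzero a b ha hb hminc
  have a1 : a ≠ 1 := by rintro rfl; exact (hone b c hb hc hmina).elim b0 c0
  have b1 : b ≠ 1 := by rintro rfl; exact (hone c a hc ha hminb).elim c0 a0
  have c1 : c ≠ 1 := by rintro rfl; exact (hone a b ha hb hminc).elim a0 b0
  have ha' : a ∈ Ioo (0 : ℝ) 1 := ⟨lt_of_le_of_ne ha.1 (Ne.symm a0), lt_of_le_of_ne ha.2 a1⟩
  have hb' : b ∈ Ioo (0 : ℝ) 1 := ⟨lt_of_le_of_ne hb.1 (Ne.symm b0), lt_of_le_of_ne hb.2 b1⟩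
  have hc' : c ∈ Ioo (0 : ℝ) 1 := ⟨lt_of_le_of_ne hc.1 (Ne.symm c0), lt_of_le_of_ne hc.2 c1⟩
  exact hF.reducedLoss_eq_of_critical hpl hL ha' hb' hc' (hF.mul_eq_marginalLoss hpl ha' hmina)
    (hF.mul_eq_marginalLoss hpl hb' hminb) (hF.mul_eq_marginalLoss hpl hc' hminc)

end IsTypeDistribution

end TeamSorting

/-! ### Joint mixability of decreasing densities, in dual form -/

namespace TeamSorting

open Filter Topology

/-- The average of `g` over `[0, x]`, with the value `g 0` at `x = 0`. -/
noncomputable def initialAverage (g : ℝ → ℝ) (x : ℝ) : ℝ := ∫ t in (0 : ℝ)..1, g (x * t)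

section

variable {g : ℝ → ℝ}

lemma continuous_initialAverage (hg : Continuous g) : Continuous (initialAverage g) := by
  unfold initialAverage
  fun_prop

lemma mul_initialAverage (g : ℝ → ℝ) (x : ℝ) :
    x * initialAverage g x = ∫ t in (0 : ℝ)..x, g t := by
  rw [initialAverage, intervalIntegral.mul_integral_comp_mul_left]
  simp

lemma initialAverage_zero (g : ℝ → ℝ) : initialAverage g 0 = g 0 := by
  simp [initialAverage]

lemma initialAverage_sub_linear (hg : Continuous g) (l x : ℝ) :
    initialAverage (fun t => g t - 2 * l * (t - 1 / 3)) x =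
      initialAverage g x - l * (x - 2 / 3) := by
  unfold initialAverage
  rw [intervalIntegral.integral_sub (Continuous.intervalIntegrable (by fun_prop) _ _)
    (Continuous.intervalIntegrable (by fun_prop) _ _), intervalIntegral.integral_const_mul,
    intervalIntegral.integral_sub (Continuous.intervalIntegrable (by fun_prop) _ _)
    (Continuous.intervalIntegrable (by fun_prop) _ _), intervalIntegral.integral_const_mul]
  simp
  ring

/-- If the averages over `[0, x]` are at least `-δ`, with equality at `x = t`, then averages over
the intervals that end at `t` are at most `-δ`. -/
lemma integral_segment_le (hg : Continuous g) {δ t p : ℝ} (hmin : -δ ≤ initialAverage g p)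
    (ht : initialAverage g t = -δ) (hp : 0 ≤ p) (hpt : p < t ∨ p = 0 ∧ t = 0) :
    ∫ s in (0 : ℝ)..1, g (p + (t - p) * s) ≤ -δ := by
  rcases hpt with h | ⟨rfl, rfl⟩
  · have h1 := intervalIntegral.mul_integral_comp_add_mul (f := g) (a := 0) (b := 1) (t - p) p
    have h2 : ∫ x in p + (t - p) * 0..p + (t - p) * 1, g x =
        t * initialAverage g t - p * initialAverage g p := by
      rw [mul_initialAverage, mul_initialAverage, mul_zero, add_zero, mul_one, add_sub_cancel,
        intervalIntegral.integral_interval_sub_left] <;> exact hg.intervalIntegrable _ _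
    rw [h2, ht] at h1
    have h3 : (t - p) * ∫ s in (0 : ℝ)..1, g (p + (t - p) * s) ≤ (t - p) * -δ := by
      rw [h1]
      nlinarith [mul_le_mul_of_nonneg_left hmin hp]
    exact le_of_mul_le_mul_left h3 (sub_pos.2 h)
  · rw [initialAverage_zero] at ht
    simp [ht]

/-- Let the averages of `g` over `[0, x]` be at least `-δ`, with equality at two contact points on
either side of `2/3`. Along suitable segments of the simplex `x + y + z = 1` the coordinates sweep
intervals whose upper end points are contact points, apart from end points at which the intervals
of two coordinates are adjacent. Averages over such intervals are at most `-δ`, so that `δ` cannot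
be positive if `g x + g y + g z` is nonnegative on the simplex. -/
lemma nonpos_of_contact (hg : Continuous g)
    (hsum : ∀ x y z : ℝ, 0 ≤ x → 0 ≤ y → 0 ≤ z → x + y + z = 1 → 0 ≤ g x + g y + g z)
    {δ s r : ℝ} (hmin : ∀ x ∈ Icc (0 : ℝ) 1, -δ ≤ initialAverage g x)
    (hs : initialAverage g s = -δ) (hr : initialAverage g r = -δ) (hs0 : 0 ≤ s) (hs1 : s ≤ 2 / 3)
    (hr0 : 2 / 3 ≤ r) (hr1 : r ≤ 1) : δ ≤ 0 := by
  have hflip : ∀ p t : ℝ, ∫ τ in (0 : ℝ)..1, g (t - (t - p) * τ) =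
      ∫ τ in (0 : ℝ)..1, g (p + (t - p) * τ) := by
    intro p t
    have := intervalIntegral.integral_comp_sub_left (a := 0) (b := 1)
      (fun τ => g (p + (t - p) * τ)) 1
    rw [sub_self, sub_zero] at this
    rw [← this]
    refine intervalIntegral.integral_congr fun τ _ => ?_
    ring_nf
  rcases lt_or_ge (1 / 3) s with h0 | h0
  · -- from `(2/3 - s, 1/3, s)` to `(s, 2/3 - s, 1/3)`
    have h1 := integral_segment_le hg (hmin (2 / 3 - s) ⟨by linarith, by linarith⟩) hs
      (by linarith) (Or.inl (by linarith))
    have h2 : (∫ τ in (0 : ℝ)..1, g (1 / 3 - (1 / 3 - (2 / 3 - s)) * τ)) +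
        ∫ τ in (0 : ℝ)..1, g (s - (s - 1 / 3) * τ) =
        2 * ∫ τ in (0 : ℝ)..1, g (2 / 3 - s + (s - (2 / 3 - s)) * τ) := by
      rw [hflip, hflip]
      have e1 := intervalIntegral.mul_integral_comp_add_mul (f := g) (a := 0) (b := 1)
        (1 / 3 - (2 / 3 - s)) (2 / 3 - s)
      have e2 := intervalIntegral.mul_integral_comp_add_mul (f := g) (a := 0) (b := 1)
        (s - 1 / 3) (1 / 3)
      have e3 := intervalIntegral.mul_integral_comp_add_mul (f := g) (a := 0) (b := 1)
        (s - (2 / 3 - s)) (2 / 3 - s)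
      simp only [mul_zero, add_zero, mul_one, add_sub_cancel] at e1 e2 e3
      have e4 := intervalIntegral.integral_add_adjacent_intervals
        (hg.intervalIntegrable (μ := volume) (2 / 3 - s) (1 / 3)) (hg.intervalIntegrable (1 / 3) s)
      have h3 : s - 1 / 3 ≠ 0 := by linarith
      refine mul_left_cancel₀ h3 ?_
      linear_combination e1 + e2 + e4 - e3
    have h4 : 0 ≤ ∫ τ in (0 : ℝ)..1, (g (2 / 3 - s + (s - (2 / 3 - s)) * τ) +
        g (1 / 3 - (1 / 3 - (2 / 3 - s)) * τ) + g (s - (s - 1 / 3) * τ)) := by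
      refine intervalIntegral.integral_nonneg zero_le_one fun τ hτ => hsum _ _ _ ?_ ?_ ?_ ?_
      · nlinarith [hτ.1, hτ.2]
      · nlinarith [hτ.1, hτ.2]
      · nlinarith [hτ.1, hτ.2]
      · ring
    rw [intervalIntegral.integral_add (Continuous.intervalIntegrable (by fun_prop) _ _)
      (Continuous.intervalIntegrable (by fun_prop) _ _), intervalIntegral.integral_add
      (Continuous.intervalIntegrable (by fun_prop) _ _)
      (Continuous.intervalIntegrable (by fun_prop) _ _)] at h4
    linarith
  rcases lt_or_ge ((1 - r) / 2) s with h | h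
  · -- from `(r, (1 - r) / 2, (1 - r) / 2)` to `(1 - 2 s, s, s)`
    have h1 := integral_segment_le hg (hmin (1 - 2 * s) ⟨by linarith, by linarith⟩) hr
      (by linarith) (Or.inl (by linarith))
    have h3 := integral_segment_le hg (hmin ((1 - r) / 2) ⟨by linarith, by linarith⟩) hs
      (by linarith) (Or.inl h)
    have h4 : 0 ≤ ∫ τ in (0 : ℝ)..1, (g (r - (r - (1 - 2 * s)) * τ) +
        g ((1 - r) / 2 + (s - (1 - r) / 2) * τ) + g ((1 - r) / 2 + (s - (1 - r) / 2) * τ)) := by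
      refine intervalIntegral.integral_nonneg zero_le_one fun τ hτ => hsum _ _ _ ?_ ?_ ?_ ?_
      · nlinarith [hτ.1, hτ.2]
      · nlinarith [hτ.1, hτ.2]
      · nlinarith [hτ.1, hτ.2]
      · ring
    rw [intervalIntegral.integral_add (Continuous.intervalIntegrable (by fun_prop) _ _)
      (Continuous.intervalIntegrable (by fun_prop) _ _), intervalIntegral.integral_add
      (Continuous.intervalIntegrable (by fun_prop) _ _)
      (Continuous.intervalIntegrable (by fun_prop) _ _), hflip] at h4
    linarith
  · -- from `(r, 0, 1 - r)` to `(1 - s - r, s, r)`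
    have h1 := integral_segment_le hg (hmin (1 - s - r) ⟨by linarith, by linarith⟩) hr
      (by linarith) (Or.inl (by linarith))
    have h2 := integral_segment_le hg (hmin (1 - r) ⟨by linarith, by linarith⟩) hr
      (by linarith) (Or.inl (by linarith))
    have h3 := integral_segment_le hg (hmin 0 ⟨by linarith, by linarith⟩) hs le_rfl
      (hs0.eq_or_lt.symm.imp id fun h => ⟨rfl, h.symm⟩)
    have h4 : 0 ≤ ∫ τ in (0 : ℝ)..1, (g (r - (r - (1 - s - r)) * τ) +
        g (0 + (s - 0) * τ) + g (1 - r + (r - (1 - r)) * τ)) := by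
      refine intervalIntegral.integral_nonneg zero_le_one fun τ hτ => hsum _ _ _ ?_ ?_ ?_ ?_
      · nlinarith [hτ.1, hτ.2]
      · nlinarith [hτ.1, hτ.2]
      · nlinarith [hτ.1, hτ.2]
      · ring
    rw [intervalIntegral.integral_add (Continuous.intervalIntegrable (by fun_prop) _ _)
      (Continuous.intervalIntegrable (by fun_prop) _ _), intervalIntegral.integral_add
      (Continuous.intervalIntegrable (by fun_prop) _ _)
      (Continuous.intervalIntegrable (by fun_prop) _ _), hflip] at h4
    linarith

/-- A function on `[0,1]` whose chords pass above `m` at `c` has a supporting line there. -/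
lemma exists_supporting_line {H : ℝ → ℝ} {m c : ℝ} (hc : c ∈ Ioo (0 : ℝ) 1)
    (hchord : ∀ θ ∈ Icc (0 : ℝ) 1, ∀ s ∈ Icc (0 : ℝ) 1, ∀ r ∈ Icc (0 : ℝ) 1,
      θ * s + (1 - θ) * r = c → m ≤ θ * H s + (1 - θ) * H r) :
    ∃ l, ∀ x ∈ Icc (0 : ℝ) 1, m + l * (x - c) ≤ H x := by
  obtain ⟨l, hl1, hl2⟩ := exists_between_of_forall_le
    (s := (fun s => (m - H s) / (c - s)) '' Ico 0 c)
    (t := (fun r => (H r - m) / (r - c)) '' Ioc c 1)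
    ⟨_, 0, ⟨le_rfl, hc.1⟩, rfl⟩ ⟨_, 1, ⟨hc.2, le_rfl⟩, rfl⟩ (by
      rintro _ ⟨s, hs, rfl⟩ _ ⟨r, hr, rfl⟩
      have h1 : 0 < c - s := by linarith [hs.2]
      have h2 : 0 < r - c := by linarith [hr.1]
      have h3 : 0 < r - s := by linarith
      have h4 := hchord ((r - c) / (r - s)) ⟨by positivity, by rw [div_le_one h3]; linarith⟩ s
        ⟨hs.1, by linarith [hc.2]⟩ r ⟨by linarith [hc.1], hr.2⟩ (by field_simp; ring)
      have h5 : (r - c) / (r - s) * H s + (1 - (r - c) / (r - s)) * H r =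
          ((r - c) * H s + (c - s) * H r) / (r - s) := by field_simp; ring
      rw [h5, le_div_iff₀ h3] at h4
      simp only
      rw [div_le_div_iff₀ h1 h2]
      linarith)
  refine ⟨l, fun x hx => ?_⟩
  rcases lt_trichotomy x c with h | rfl | h
  · have h1 := hl1 ⟨x, ⟨hx.1, h⟩, rfl⟩
    simp only at h1
    rw [div_le_iff₀ (by linarith)] at h1
    linarith
  · have := hchord 1 (by simp) x hx x hx (by ring)
    simpa using this
  · have h1 := hl2 ⟨x, ⟨h, hx.2⟩, rfl⟩
    simp only at h1
    rw [le_div_iff₀ (by linarith)] at h1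
    linarith

/-- If `g x + g y + g z` is nonnegative on the simplex `x + y + z = 1`, then, after subtraction of a
multiple of `x - 1/3`, the integrals of `g` over all intervals `[0, x]` are nonnegative. -/
lemma exists_linear_le_initialAverage (hg : Continuous g)
    (hsum : ∀ x y z : ℝ, 0 ≤ x → 0 ≤ y → 0 ≤ z → x + y + z = 1 → 0 ≤ g x + g y + g z) :
    ∃ l, ∀ x ∈ Icc (0 : ℝ) 1, l * (x - 2 / 3) ≤ initialAverage g x := by
  have hcont := continuous_initialAverage hg
  set T : Set (ℝ × ℝ × ℝ) := (Icc (0 : ℝ) 1 ×ˢ Icc (0 : ℝ) 1 ×ˢ Icc (0 : ℝ) 1) ∩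
    {t | t.1 * t.2.1 + (1 - t.1) * t.2.2 = 2 / 3} with hT
  have hTc : IsCompact T :=
    (isCompact_Icc.prod (isCompact_Icc.prod isCompact_Icc)).inter_right
      (isClosed_eq (by fun_prop) (by fun_prop))
  obtain ⟨⟨θ, s, r⟩, ⟨⟨hθ, hs, hr⟩, heq⟩, hmin⟩ := hTc.exists_isMinOn
    ⟨(0, 2 / 3, 2 / 3), by rw [hT]; norm_num⟩
    (f := fun t => t.1 * initialAverage g t.2.1 + (1 - t.1) * initialAverage g t.2.2)
    (by fun_prop)
  simp only at hθ hs hr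
  replace heq : θ * s + (1 - θ) * r = 2 / 3 := heq
  have hchord : ∀ θ' ∈ Icc (0 : ℝ) 1, ∀ s' ∈ Icc (0 : ℝ) 1, ∀ r' ∈ Icc (0 : ℝ) 1,
      θ' * s' + (1 - θ') * r' = 2 / 3 →
      θ * initialAverage g s + (1 - θ) * initialAverage g r ≤
        θ' * initialAverage g s' + (1 - θ') * initialAverage g r' :=
    fun θ' h1 s' h2 r' h3 h4 => hmin (show (θ', s', r') ∈ T from ⟨⟨h1, h2, h3⟩, h4⟩)
  obtain ⟨δ, hδ⟩ : ∃ δ, θ * initialAverage g s + (1 - θ) * initialAverage g r = -δ :=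
    ⟨_, (neg_neg _).symm⟩
  rw [hδ] at hchord
  obtain ⟨l, hl⟩ := exists_supporting_line (by norm_num) hchord
  suffices h : δ ≤ 0 from ⟨l, fun x hx => by linarith [hl x hx]⟩
  -- subtract the supporting line
  set k : ℝ → ℝ := fun t => g t - 2 * l * (t - 1 / 3) with hk
  have hkc : Continuous k := by fun_prop
  have hksum : ∀ x y z : ℝ, 0 ≤ x → 0 ≤ y → 0 ≤ z → x + y + z = 1 → 0 ≤ k x + k y + k z := by
    intro x y z hx hy hz h
    have h1 := hsum x y z hx hy hz h
    have h2 : k x + k y + k z = g x + g y + g z := by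
      simp only [hk]
      linear_combination -2 * l * h
    rwa [h2]
  have hkavg : ∀ x, initialAverage k x = initialAverage g x - l * (x - 2 / 3) :=
    initialAverage_sub_linear hg l
  have hkmin : ∀ x ∈ Icc (0 : ℝ) 1, -δ ≤ initialAverage k x := fun x hx => by
    rw [hkavg]; linarith [hl x hx]
  have hkeq : θ * initialAverage k s + (1 - θ) * initialAverage k r = -δ := by
    rw [hkavg, hkavg]; linear_combination hδ - l * heq
  rcases hθ.1.eq_or_lt with rfl | hθ0
  · have h1 : r = 2 / 3 := by linarith
    have h2 : initialAverage k r = -δ := by linarith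
    exact nonpos_of_contact hkc hksum hkmin h2 h2 hr.1 h1.le h1.ge hr.2
  rcases hθ.2.eq_or_lt with rfl | hθ1
  · have h1 : s = 2 / 3 := by linarith
    have h2 : initialAverage k s = -δ := by linarith
    exact nonpos_of_contact hkc hksum hkmin h2 h2 hs.1 h1.le h1.ge hs.2
  have hθ1' : 0 < 1 - θ := by linarith
  have e1 : initialAverage k s = -δ := by
    refine le_antisymm (le_of_mul_le_mul_left ?_ hθ0) (hkmin s hs)
    nlinarith [hkmin r hr]
  have e2 : initialAverage k r = -δ := by
    refine le_antisymm (le_of_mul_le_mul_left ?_ hθ1') (hkmin r hr)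
    nlinarith [hkmin s hs]
  rcases le_total s (2 / 3) with h | h
  · refine nonpos_of_contact hkc hksum hkmin e1 e2 hs.1 h ?_ hr.2
    refine le_of_mul_le_mul_left ?_ hθ1'
    nlinarith
  · refine nonpos_of_contact hkc hksum hkmin e2 e1 hr.1 ?_ h hs.2
    refine le_of_mul_le_mul_left ?_ hθ1'
    nlinarith

/-- A function with nonnegative integrals over all intervals `[0, x]` has a nonnegative integral
against decreasing weights: by the layer cake formula the weight is an average of indicator
functions of such intervals. -/
lemma integral_mul_antitone_nonneg {e h : ℝ → ℝ} (he : Continuous e) (hh : Continuous h)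
    (hanti : AntitoneOn h (Icc 0 1)) (hpos : ∀ x ∈ Icc (0 : ℝ) 1, 0 ≤ h x)
    (hE : ∀ x ∈ Icc (0 : ℝ) 1, 0 ≤ ∫ t in (0 : ℝ)..x, e t) :
    0 ≤ ∫ t in (0 : ℝ)..1, e t * h t := by
  set M := h 0
  set μ := volume.restrict (Icc (0 : ℝ) 1)
  set ν := volume.restrict (Icc (0 : ℝ) M)
  have h1 : ∀ x ∈ Icc (0 : ℝ) 1, ∫ u, (Iio (h x)).indicator (fun _ => e x) u ∂ν = e x * h x := by
    intro x hx
    rw [integral_indicator measurableSet_Iio, setIntegral_const, smul_eq_mul, mul_comm]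
    congr 1
    rw [measureReal_restrict_apply measurableSet_Iio]
    have h2 : Iio (h x) ∩ Icc 0 M = Ico 0 (h x) := by
      ext u
      have := hanti (left_mem_Icc.2 zero_le_one) hx hx.1
      simp only [mem_inter_iff, mem_Iio, mem_Icc, mem_Ico]
      constructor
      · rintro ⟨a, b, c⟩; exact ⟨b, a⟩
      · rintro ⟨a, b⟩; exact ⟨b, a, b.le.trans this⟩
    rw [h2, Real.volume_real_Ico_of_le (hpos x hx), sub_zero]
  rw [intervalIntegral.integral_of_le zero_le_one, ← integral_Icc_eq_integral_Ioc,
    ← setIntegral_congr_fun measurableSet_Icc h1, integral_integral_swap]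
  · refine integral_nonneg fun u => ?_
    have h2 : (fun x => (Iio (h x)).indicator (fun _ => e x) u) = {x | u < h x}.indicator e := by
      ext x
      simp only [indicator, mem_Iio, mem_ofPred_eq]
    have hmeas : MeasurableSet {x | u < h x} := (isOpen_lt continuous_const hh).measurableSet
    simp only [h2, Pi.zero_apply]
    rw [integral_indicator hmeas, Measure.restrict_restrict hmeas]
    set A : Set ℝ := {x | u < h x} ∩ Icc 0 1
    rcases A.eq_empty_or_nonempty with h3 | h3
    · simp [h3]
    · have hbdd : BddAbove A := ⟨1, fun x hx => hx.2.2⟩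
      set σ := sSup A
      have hσ : σ ∈ Icc (0 : ℝ) 1 := by
        obtain ⟨x, hx⟩ := h3
        exact ⟨hx.2.1.trans (le_csSup hbdd hx), csSup_le ⟨x, hx⟩ fun y hy => hy.2.2⟩
      have h4 : A =ᵐ[volume] Ioc 0 σ := by
        refine Filter.EventuallyEq.trans ?_ Ico_ae_eq_Ioc
        have h5 : Ico 0 σ ⊆ A := by
          intro x hx
          obtain ⟨y, hy, hxy⟩ := exists_lt_of_lt_csSup h3 hx.2
          have hx1 : x ∈ Icc (0 : ℝ) 1 := ⟨hx.1, hx.2.le.trans hσ.2⟩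
          exact ⟨lt_of_lt_of_le hy.1 (hanti hx1 hy.2 hxy.le), hx1⟩
        have h6 : A ⊆ Icc 0 σ := fun x hx =>
          ⟨hx.2.1, le_csSup hbdd hx⟩
        have h7 : Icc 0 σ ≤ᵐ[volume] Ico 0 σ := Ico_ae_eq_Icc.symm.le
        exact ((LE.le.eventuallyLE h6).trans h7).antisymm (LE.le.eventuallyLE h5)
      rw [setIntegral_congr_set h4, ← intervalIntegral.integral_of_le hσ.1]
      exact hE σ hσ
  · obtain ⟨K, hK⟩ := (isCompact_Icc (a := (0 : ℝ)) (b := 1)).exists_bound_of_continuousOn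
      he.continuousOn
    have hfin : IsFiniteMeasure (μ.prod ν) := inferInstance
    have hset : MeasurableSet {p : ℝ × ℝ | p.2 < h p.1} :=
      (isOpen_lt (by fun_prop) (by fun_prop)).measurableSet
    have h2 : Function.uncurry (fun x u => (Iio (h x)).indicator (fun _ => e x) u) =
        {p : ℝ × ℝ | p.2 < h p.1}.indicator fun p => e p.1 := by
      ext p
      simp only [Function.uncurry, indicator, mem_Iio, mem_ofPred_eq]
    rw [h2]
    refine Integrable.indicator ?_ hset
    have h3 : Integrable e μ := he.continuousOn.integrableOn_Icc
    exact h3.comp_fst ν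

/-- A decreasing density on `[0,1]` with mean `1/3` is jointly mixable, in dual form: three
variables with this density can add up to `1`, hence its integral of `g` is nonnegative whenever
`g x + g y + g z` is nonnegative on the simplex. -/
theorem integral_mul_nonneg_of_simplex (hg : Continuous g)
    (hsum : ∀ x y z : ℝ, 0 ≤ x → 0 ≤ y → 0 ≤ z → x + y + z = 1 → 0 ≤ g x + g y + g z)
    {h : ℝ → ℝ} (hh : Continuous h) (hanti : AntitoneOn h (Icc 0 1))
    (hpos : ∀ x ∈ Icc (0 : ℝ) 1, 0 ≤ h x)
    (hmean : ∫ t in (0 : ℝ)..1, t * h t = (∫ t in (0 : ℝ)..1, h t) / 3) :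
    0 ≤ ∫ t in (0 : ℝ)..1, g t * h t := by
  obtain ⟨l, hl⟩ := exists_linear_le_initialAverage hg hsum
  have hkc : Continuous (fun t => g t - 2 * l * (t - 1 / 3)) := by fun_prop
  have h1 := integral_mul_antitone_nonneg hkc hh hanti hpos (by
    intro x hx
    rw [← mul_initialAverage, initialAverage_sub_linear hg]
    exact mul_nonneg hx.1 (by linarith [hl x hx]))
  have h2 : ∀ t, (g t - 2 * l * (t - 1 / 3)) * h t =
      g t * h t - 2 * l * (t * h t) + 2 * l / 3 * h t := fun t => by ring
  simp only [h2] at h1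
  rw [intervalIntegral.integral_add (Continuous.intervalIntegrable (by fun_prop) _ _)
    (Continuous.intervalIntegrable (by fun_prop) _ _), intervalIntegral.integral_sub
    (Continuous.intervalIntegrable (by fun_prop) _ _)
    (Continuous.intervalIntegrable (by fun_prop) _ _), intervalIntegral.integral_const_mul,
    intervalIntegral.integral_const_mul, hmean] at h1
  linarith

end

end TeamSorting

/-! ### Couplings on a compact set, by duality -/

namespace TeamSorting

open Filter Topology
open scoped BoundedContinuousFunction CompactlySupported NNReal

/-- The pairs of a triple `g` of functions of one variable and a function `u` on `K` for which
`g₁(x) + g₂(y) + g₃(z) + u(x, y, z)` is nonnegative on `K`. -/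
def couplingCone (K : Set (ℝ × ℝ × ℝ)) :
    PointedCone ℝ (((ℝ →ᵇ ℝ) × (ℝ →ᵇ ℝ) × (ℝ →ᵇ ℝ)) × C_c(K, ℝ)) where
  carrier := {e | ∀ t : K, 0 ≤ e.1.1 t.1.1 + e.1.2.1 t.1.2.1 + e.1.2.2 t.1.2.2 + e.2 t}
  add_mem' := by
    intro a b ha hb t
    have h1 := ha t
    have h2 := hb t
    simp only [Prod.fst_add, Prod.snd_add, BoundedContinuousFunction.coe_add, Pi.add_apply,
      CompactlySupportedContinuousMap.coe_add]
    linarith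
  zero_mem' := by
    intro t
    simp
  smul_mem' := by
    intro c a ha t
    have h1 := mul_nonneg c.2 (ha t)
    change 0 ≤ (c : ℝ) * a.1.1 t.1.1 + (c : ℝ) * a.1.2.1 t.1.2.1 + (c : ℝ) * a.1.2.2 t.1.2.2 +
      (c : ℝ) * a.2 t
    linarith

/-- The sum of the integrals of three functions of one variable, as a linear functional. -/
noncomputable def marginalIntegral (μ : Measure ℝ) [IsProbabilityMeasure μ] :
    ((ℝ →ᵇ ℝ) × (ℝ →ᵇ ℝ) × (ℝ →ᵇ ℝ)) →ₗ[ℝ] ℝ where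
  toFun g := ∫ x, g.1 x ∂μ + ∫ x, g.2.1 x ∂μ + ∫ x, g.2.2 x ∂μ
  map_add' a b := by
    simp only [Prod.fst_add, Prod.snd_add, BoundedContinuousFunction.coe_add, Pi.add_apply]
    rw [integral_add (a.1.integrable μ) (b.1.integrable μ),
      integral_add (a.2.1.integrable μ) (b.2.1.integrable μ),
      integral_add (a.2.2.integrable μ) (b.2.2.integrable μ)]
    ring
  map_smul' c a := by
    simp only [Prod.smul_fst, Prod.smul_snd, BoundedContinuousFunction.coe_smul, smul_eq_mul,
      integral_const_mul, RingHom.id_apply]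
    ring

/-- A probability measure is the marginal of a coupling of three of its copies that is concentrated
on a compact set `K`, invariant under rotation, if its integral of `g` is nonnegative whenever
`g x + g y + g z` is nonnegative on `K`. The functional that integrates sums of functions of one
variable extends to a positive functional, and this is represented by a measure. -/
theorem exists_coupling_of_forall_integral_nonneg {K : Set (ℝ × ℝ × ℝ)} (hK : IsCompact K)
    (hrot : ∀ x y z, (x, y, z) ∈ K → (y, z, x) ∈ K) (μ : Measure ℝ) [IsProbabilityMeasure μ]
    (h : ∀ g : ℝ →ᵇ ℝ, (∀ x y z, (x, y, z) ∈ K → 0 ≤ g x + g y + g z) → 0 ≤ ∫ x, g x ∂μ) :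
    ∃ π : Measure (ℝ × ℝ × ℝ), IsProbabilityMeasure π ∧ (∀ᵐ t ∂π, t ∈ K) ∧
      π.map (fun t => t.1) = μ ∧ π.map (fun t => t.2.1) = μ ∧ π.map (fun t => t.2.2) = μ := by
  have hcomp : CompactSpace K := isCompact_iff_compactSpace.1 hK
  let D : Submodule ℝ (((ℝ →ᵇ ℝ) × (ℝ →ᵇ ℝ) × (ℝ →ᵇ ℝ)) × C_c(K, ℝ)) := Submodule.prod ⊤ ⊥
  let φ : (((ℝ →ᵇ ℝ) × (ℝ →ᵇ ℝ) × (ℝ →ᵇ ℝ)) × C_c(K, ℝ)) →ₗ.[ℝ] ℝ :=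
    ⟨D, (marginalIntegral μ ∘ₗ LinearMap.fst ℝ _ _) ∘ₗ D.subtype⟩
  have hφ : ∀ x : φ.domain, φ x = marginalIntegral μ x.1.1 := fun _ => rfl
  obtain ⟨Λ, hΛ1, hΛ2⟩ := riesz_extension (couplingCone K) φ
    (by
      rintro ⟨⟨g, u⟩, hgu⟩ hmem
      have hu : u = 0 := hgu.2
      subst hu
      rw [hφ]
      -- by invariance only the sum of the three functions matters
      have h1 := h (g.1 + g.2.1 + g.2.2) (by
        intro x y z hxyz
        have a1 := hmem ⟨_, hxyz⟩
        have a2 := hmem ⟨_, hrot _ _ _ hxyz⟩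
        have a3 := hmem ⟨_, hrot _ _ _ (hrot _ _ _ hxyz)⟩
        simp only [CompactlySupportedContinuousMap.coe_zero, Pi.zero_apply, add_zero] at a1 a2 a3
        simp only [BoundedContinuousFunction.coe_add, Pi.add_apply]
        linarith)
      simp only [BoundedContinuousFunction.coe_add, Pi.add_apply] at h1
      rw [integral_add (f := fun x => g.1 x + g.2.1 x)
        ((g.1.integrable μ).add (g.2.1.integrable μ)) (g.2.2.integrable μ),
        integral_add (g.1.integrable μ) (g.2.1.integrable μ)] at h1
      exact h1)
    (by
      rintro ⟨g, u⟩
      obtain ⟨N, hN⟩ := (isCompact_univ (X := K)).exists_bound_of_continuousOn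
        u.continuous.continuousOn
      refine ⟨⟨((BoundedContinuousFunction.const ℝ N - g.1, -g.2.1, -g.2.2), 0),
        Submodule.mem_top, rfl⟩, fun t => ?_⟩
      have h1 : -N ≤ u t := (abs_le.1 (hN t (mem_univ t))).1
      simp
      linarith)
  have hpos : ∀ u : C_c(K, ℝ), 0 ≤ u → 0 ≤ Λ (0, u) := by
    intro u hu
    refine hΛ2 _ fun t => ?_
    have : 0 ≤ u t := hu t
    simpa using this
  let Λ' : C_c(K, ℝ) →ₚ[ℝ] ℝ := PositiveLinearMap.mk₀ (Λ ∘ₗ LinearMap.inr ℝ _ _) hpos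
  have hrep := RealRMK.integral_rieszMeasure Λ'
  set ν := RealRMK.rieszMeasure Λ'
  have hν : IsFiniteMeasure ν := inferInstance
  have hval : ∀ g : (ℝ →ᵇ ℝ) × (ℝ →ᵇ ℝ) × (ℝ →ᵇ ℝ),
      ∫ t, (g.1 t.1.1 + g.2.1 t.1.2.1 + g.2.2 t.1.2.2) ∂ν = marginalIntegral μ g := by
    intro g
    let u : C_c(K, ℝ) := ⟨⟨fun t => g.1 t.1.1 + g.2.1 t.1.2.1 + g.2.2 t.1.2.2, by fun_prop⟩,
      HasCompactSupport.of_compactSpace _⟩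
    have h1 : ∫ t, u t ∂ν = Λ (0, u) := hrep u
    have h2 : Λ (g, 0) = marginalIntegral μ g :=
      hΛ1 ⟨(g, 0), Submodule.mem_top, rfl⟩
    have hu : ∀ t, u t = g.1 t.1.1 + g.2.1 t.1.2.1 + g.2.2 t.1.2.2 := fun _ => rfl
    have h3 : 0 ≤ Λ (g, -u) := hΛ2 _ fun t => by
      simp only [CompactlySupportedContinuousMap.coe_neg, Pi.neg_apply, hu]
      linarith
    have h4 : 0 ≤ Λ (-g, u) := hΛ2 _ fun t => by
      simp only [Prod.fst_neg, Prod.snd_neg, BoundedContinuousFunction.coe_neg, Pi.neg_apply, hu]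
      linarith
    have h5 : ((g, -u) : _ × C_c(K, ℝ)) = (g, 0) - (0, u) := by simp
    have h6 : ((-g, u) : _ × C_c(K, ℝ)) = (0, u) - (g, 0) := by simp
    rw [h5, map_sub] at h3
    rw [h6, map_sub] at h4
    rw [← h2]
    calc _ = ∫ t, u t ∂ν := integral_congr_ae (Eventually.of_forall fun t => (hu t).symm)
      _ = Λ (g, 0) := by linarith
  have hmap : ∀ c : ℝ × ℝ × ℝ → ℝ, Measurable c →
      (∀ k : ℝ →ᵇ ℝ, ∫ t : K, k (c t.1) ∂ν = ∫ x, k x ∂μ) →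
      (ν.map Subtype.val).map c = μ := by
    intro c hc hk
    refine ext_of_forall_integral_eq_of_IsFiniteMeasure fun k => ?_
    rw [Measure.map_map hc measurable_subtype_coe, integral_map
      (hc.comp measurable_subtype_coe).aemeasurable k.continuous.aestronglyMeasurable, ← hk k]
    rfl
  have e1 := hmap (fun t => t.1) (by fun_prop) fun k => by
    simpa [marginalIntegral] using hval (k, 0, 0)
  have e2 := hmap (fun t => t.2.1) (by fun_prop) fun k => by
    simpa [marginalIntegral] using hval (0, k, 0)
  have e3 := hmap (fun t => t.2.2) (by fun_prop) fun k => by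
    simpa [marginalIntegral] using hval (0, 0, k)
  refine ⟨ν.map Subtype.val, ⟨?_⟩, ?_, e1, e2, e3⟩
  · have h1 : μ univ = 1 := measure_univ
    rwa [← e1, Measure.map_apply (by fun_prop) MeasurableSet.univ, preimage_univ] at h1
  · rw [ae_iff]
    change ν.map Subtype.val Kᶜ = 0
    rw [Measure.map_apply measurable_subtype_coe hK.measurableSet.compl]
    simp

end TeamSorting

/-! ### An assignment concentrated on the minimisers of the reduced loss -/

namespace TeamSorting

open Filter Topology
open scoped BoundedContinuousFunction

/-- The triples of types at which the reduced loss attains its minimum. -/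
def contactSet (F : Measure ℝ) (pl : ℝ) : Set (ℝ × ℝ × ℝ) :=
  (Icc (0 : ℝ) 1 ×ˢ Icc (0 : ℝ) 1 ×ˢ Icc (0 : ℝ) 1) ∩
    {t | reducedLoss F pl t.1 t.2.1 t.2.2 = minLoss F pl}

namespace IsTypeDistribution

variable {F : Measure ℝ} {f : ℝ → ℝ} {pl : ℝ}

lemma isCompact_contactSet (hF : IsTypeDistribution F f) (hpl : IsLowerBound F pl) :
    IsCompact (contactSet F pl) := by
  have hcont := hF.continuous_lossPotential hpl
  refine (isCompact_Icc.prod (isCompact_Icc.prod isCompact_Icc)).inter_right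
    (isClosed_eq ?_ continuous_const)
  unfold reducedLoss
  fun_prop

/-- Integrals over the middle percentiles in the coordinate `t = log (b / x) / log (b / a)`, where
the types of the middle interval are `[a, b]`. The density in this coordinate is a multiple of
`x f(x)`, hence nonincreasing, and by the cutoff equation its mean is `1/3`. -/
lemma exists_middle_density (hF : IsTypeDistribution F f) (hpl : IsLowerBound F pl)
    (hA : DistributionAssumption F f pl) (hlt : pl < 1 / 3) {a b : ℝ}
    (ha : a = invCdf F pl) (hb : b = invCdf F (1 - 2 * pl)) :
    ∃ h : ℝ → ℝ, Continuous h ∧ AntitoneOn h (Icc 0 1) ∧ (∀ t ∈ Icc (0 : ℝ) 1, 0 ≤ h t) ∧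
      (∫ t in (0 : ℝ)..1, t * h t = (∫ t in (0 : ℝ)..1, h t) / 3) ∧
      ∀ u : ℝ → ℝ, ContinuousOn u (Icc a b) → ∫ p in pl..(1 - 2 * pl), u (invCdf F p) =
        ∫ t in (0 : ℝ)..1, u (b * Real.exp (-Real.log (b / a) * t)) * h t := by
  have h0 := hpl.mem_Ioc.1
  have hpl1 : pl ∈ Icc (0 : ℝ) 1 := ⟨h0.le, by linarith⟩
  have hpl2 : 1 - 2 * pl ∈ Icc (0 : ℝ) 1 := ⟨by linarith, by linarith⟩
  have ha0 : 0 < a := ha ▸ hF.invCdf_pos h0 hpl1.2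
  have hab : a < b := by
    rw [ha, hb]; exact hF.strictMonoOn_invCdf hpl1 hpl2 (by linarith)
  have hb0 : 0 < b := ha0.trans hab
  have hb1 : b < 1 := hb ▸ hF.invCdf_lt_one hpl2.1 (by linarith)
  have hcdfa : cdf F a = pl := by rw [ha, hF.cdf_invCdf hpl1]
  have hcdfb : cdf F b = 1 - 2 * pl := by rw [hb, hF.cdf_invCdf hpl2]
  obtain ⟨A, hAdef⟩ : ∃ A, A = Real.log (b / a) := ⟨_, rfl⟩
  have hA0 : 0 < A := by rw [hAdef]; exact Real.log_pos ((one_lt_div ha0).2 hab)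
  have hexpA : b * Real.exp (-A) = a := by
    rw [hAdef, Real.exp_neg, Real.exp_log (by positivity)]
    field_simp
  rw [← hAdef]
  set X : ℝ → ℝ := fun t => b * Real.exp (-A * t) with hX
  have hXc : Continuous X := by fun_prop
  have hXanti : Antitone X := by
    intro s t hst
    refine mul_le_mul_of_nonneg_left (Real.exp_le_exp.2 ?_) hb0.le
    nlinarith
  have hX0 : X 0 = b := by simp [hX]
  have hX1 : X 1 = a := by simp [hX, hexpA]
  have hXmem : ∀ t ∈ Icc (0 : ℝ) 1, X t ∈ Icc a b := by
    intro t ht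
    constructor
    · rw [← hX1]; exact hXanti ht.2
    · rw [← hX0]; exact hXanti ht.1
  have hsub : Icc a b ⊆ Ioo (0 : ℝ) 1 := fun x hx => ⟨ha0.trans_le hx.1, hx.2.trans_lt hb1⟩
  have hmono : MonotoneOn (fun x => x * f x) (Icc a b) := by
    rw [ha, hb]; exact hA.monotoneOn
  set h : ℝ → ℝ := fun t =>
    A * (X (projIcc (0 : ℝ) 1 zero_le_one t) * f (X (projIcc (0 : ℝ) 1 zero_le_one t))) with hh
  have hmem : ∀ t ∈ Icc (0 : ℝ) 1, h t = A * (X t * f (X t)) := by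
    intro t ht
    simp only [hh, projIcc_of_mem _ ht]
  have hcont : Continuous h := by
    refine continuous_const.mul ?_
    have h1 : ContinuousOn (fun x => x * f x) (Icc a b) :=
      continuousOn_id.mul (hF.continuousOn.mono hsub)
    exact h1.comp_continuous
      (hXc.comp (continuous_subtype_val.comp continuous_projIcc)) fun t => hXmem _ (Subtype.mem _)
  have hanti : AntitoneOn h (Icc 0 1) := by
    intro s hs t ht hst
    rw [hmem s hs, hmem t ht]
    exact mul_le_mul_of_nonneg_left (hmono (hXmem t ht) (hXmem s hs) (hXanti hst)) hA0.le
  have hpos : ∀ t ∈ Icc (0 : ℝ) 1, 0 ≤ h t := by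
    intro t ht
    rw [hmem t ht]
    have h1 := hsub (hXmem t ht)
    exact mul_nonneg hA0.le (mul_nonneg h1.1.le (hF.nonneg _ h1))
  have hchange : ∀ u : ℝ → ℝ, ContinuousOn u (Icc a b) →
      ∫ p in pl..(1 - 2 * pl), u (invCdf F p) = ∫ t in (0 : ℝ)..1, u (X t) * h t := by
    intro u hu
    have hder : ∀ t ∈ Icc (0 : ℝ) 1, HasDerivAt (fun t => cdf F (X t)) (-h t) t := by
      intro t ht
      have h1 : HasDerivAt X (b * (Real.exp (-A * t) * (-A * 1))) t :=
        (((hasDerivAt_id t).const_mul (-A)).exp).const_mul b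
      have h2 := (hF.hasDerivAt_cdf (hsub (hXmem t ht))).comp t h1
      have h3 : f (X t) * (b * (Real.exp (-A * t) * (-A * 1))) = -h t := by
        rw [hmem t ht]; simp only [hX]; ring
      rwa [h3] at h2
    have himage : (fun t => cdf F (X t)) '' uIcc 0 1 ⊆ Icc pl (1 - 2 * pl) := by
      rintro _ ⟨t, ht, rfl⟩
      rw [uIcc_of_le zero_le_one] at ht
      have h1 := hXmem t ht
      exact ⟨hcdfa ▸ monotone_cdf F h1.1, hcdfb ▸ monotone_cdf F h1.2⟩
    have hsubst := intervalIntegral.integral_comp_mul_deriv'' (a := 0) (b := 1)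
      (f := fun t => cdf F (X t)) (f' := fun t => -h t) (g := fun p => u (invCdf F p))
      (hF.continuous_cdf.comp hXc).continuousOn
      (fun t ht => (hder t ⟨by simpa using ht.1.le, by simpa using ht.2.le⟩).hasDerivWithinAt)
      hcont.neg.continuousOn
      (by
        refine ContinuousOn.mono ?_ himage
        refine hu.comp (hF.continuousOn_invCdf.mono fun p hp => ⟨h0.le.trans hp.1,
          hp.2.trans hpl2.2⟩) fun p hp => ?_
        have hp1 : p ∈ Icc (0 : ℝ) 1 := ⟨h0.le.trans hp.1, hp.2.trans hpl2.2⟩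
        rw [ha, hb]
        exact ⟨hF.strictMonoOn_invCdf.monotoneOn hpl1 hp1 hp.1,
          hF.strictMonoOn_invCdf.monotoneOn hp1 hpl2 hp.2⟩)
    simp only [hX0, hX1, hcdfa, hcdfb, Function.comp_apply] at hsubst
    rw [intervalIntegral.integral_symm, ← hsubst, ← intervalIntegral.integral_neg]
    refine intervalIntegral.integral_congr fun t ht => ?_
    rw [uIcc_of_le zero_le_one] at ht
    rw [hF.invCdf_cdf (Ioo_subset_Icc_self (hsub (hXmem t ht)))]
    ring
  refine ⟨h, hcont, hanti, hpos, ?_, hchange⟩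
  have hmass := hchange (fun _ => 1) continuousOn_const
  have hmean := hchange (fun x => (Real.log b - Real.log x) / A)
    ((continuousOn_const.sub (Real.continuousOn_log.mono fun x hx =>
      (ha0.trans_le hx.1).ne')).div_const A)
  have h1 : ∀ t, (Real.log b - Real.log (X t)) / A = t := by
    intro t
    simp only [hX]
    rw [Real.log_mul hb0.ne' (Real.exp_ne_zero _), Real.log_exp]
    field_simp
    ring
  have hint : IntervalIntegrable (fun p => Real.log (invCdf F p)) volume pl (1 - 2 * pl) :=
    (hF.continuousOn_log_invCdf.mono fun x hx =>
      ⟨h0.trans_le hx.1, hx.2.trans hpl2.2⟩).intervalIntegrable_of_Icc (by linarith)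
  simp only [h1] at hmean
  simp only [one_mul, intervalIntegral.integral_const, smul_eq_mul, mul_one] at hmass
  rw [intervalIntegral.integral_div, intervalIntegral.integral_sub intervalIntegrable_const hint,
    hF.integral_log_invCdf_lowerBound hpl, intervalIntegral.integral_const, smul_eq_mul, logLoss,
    ← ha, ← hb] at hmean
  rw [← hmean, ← hmass, hAdef, Real.log_div hb0.ne' ha0.ne']
  rw [hAdef, Real.log_div hb0.ne' ha0.ne'] at hA0
  rw [div_eq_iff hA0.ne']
  ring

/-- The mixing of the middle types: the integral over the middle percentiles of a function whose
sums are nonnegative on the minimisers of the reduced loss is nonnegative. -/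
lemma integral_middle_nonneg (hF : IsTypeDistribution F f) (hpl : IsLowerBound F pl)
    (hA : DistributionAssumption F f pl) {g : ℝ → ℝ} (hg : Continuous g)
    (h : ∀ x y z, (x, y, z) ∈ contactSet F pl → 0 ≤ g x + g y + g z) :
    0 ≤ ∫ p in pl..(1 - 2 * pl), g (invCdf F p) := by
  have h0 := hpl.mem_Ioc
  rcases h0.2.eq_or_lt with heq | hlt
  · rw [show 1 - 2 * pl = pl by linarith]; simp
  obtain ⟨a, ha⟩ : ∃ a, a = invCdf F pl := ⟨_, rfl⟩
  obtain ⟨b, hb⟩ : ∃ b, b = invCdf F (1 - 2 * pl) := ⟨_, rfl⟩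
  obtain ⟨k, hk1, hk2, hk3, hk4, hk5⟩ := hF.exists_middle_density hpl hA hlt ha hb
  have hpl1 : pl ∈ Icc (0 : ℝ) 1 := ⟨h0.1.le, by linarith⟩
  have hpl2 : 1 - 2 * pl ∈ Icc (0 : ℝ) 1 := ⟨by linarith, by linarith [h0.1]⟩
  have ha0 : 0 < a := ha ▸ hF.invCdf_pos h0.1 hpl1.2
  have hab : a < b := by
    rw [ha, hb]; exact hF.strictMonoOn_invCdf hpl1 hpl2 (by linarith)
  have hb0 : 0 < b := ha0.trans hab
  have hb1 : b ≤ 1 := hb ▸ (hF.invCdf_mem hpl2).2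
  have hlog : 0 < Real.log (b / a) := Real.log_pos ((one_lt_div ha0).2 hab)
  have hexp : Real.exp (-Real.log (b / a)) = a / b := by
    rw [Real.exp_neg, Real.exp_log (by positivity), inv_div]
  rw [hk5 g hg.continuousOn]
  refine integral_mul_nonneg_of_simplex (g := fun t => g (b * Real.exp (-Real.log (b / a) * t)))
    (by fun_prop) (fun x y z hx hy hz hxyz => ?_) hk1 hk2 hk3 hk4
  have hmem : ∀ t, 0 ≤ t → t ≤ 1 → b * Real.exp (-Real.log (b / a) * t) ∈ Icc a b := by
    intro t ht0 ht1
    constructor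
    · calc a = b * Real.exp (-Real.log (b / a)) := by rw [hexp]; field_simp
        _ ≤ _ := mul_le_mul_of_nonneg_left (Real.exp_le_exp.2 (by nlinarith)) hb0.le
    · calc _ ≤ b * 1 := mul_le_mul_of_nonneg_left (Real.exp_le_one_iff.2 (by nlinarith)) hb0.le
        _ = b := mul_one b
  have mx := hmem x hx (by linarith)
  have my := hmem y hy (by linarith)
  have mz := hmem z hz (by linarith)
  have hcube : Icc a b ⊆ Icc (0 : ℝ) 1 := Icc_subset_Icc ha0.le hb1
  refine h _ _ _ ⟨⟨hcube mx, hcube my, hcube mz⟩, ?_⟩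
  have hprod : b * Real.exp (-Real.log (b / a) * x) * (b * Real.exp (-Real.log (b / a) * y)) *
      (b * Real.exp (-Real.log (b / a) * z)) = tailLoss F pl := by
    have h1 : Real.exp (-Real.log (b / a) * x) * Real.exp (-Real.log (b / a) * y) *
        Real.exp (-Real.log (b / a) * z) = a / b := by
      rw [← Real.exp_add, ← Real.exp_add, ← hexp]
      congr 1
      linear_combination (-Real.log (b / a)) * hxyz
    rw [tailLoss, ← ha, ← hb]
    calc _ = b ^ 3 * (Real.exp (-Real.log (b / a) * x) * Real.exp (-Real.log (b / a) * y) *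
        Real.exp (-Real.log (b / a) * z)) := by ring
      _ = a * b ^ 2 := by rw [h1]; field_simp
  rw [ha, hb] at mx my mz
  rw [ha, hb] at hprod ⊢
  exact hF.reducedLoss_middle hpl hA.concaveOn ⟨h0.1, le_rfl⟩ rfl mx my mz hprod

/-- There is an assignment of the workers, coworkers and firms under which almost every triple
minimises the reduced loss. -/
theorem exists_assignment_contactSet (hF : IsTypeDistribution F f) (hpl : IsLowerBound F pl)
    (hA : DistributionAssumption F f pl) :
    ∃ π, IsAssignment F F π ∧ ∀ᵐ t ∂π, t ∈ contactSet F pl := by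
  have := hF.isProbabilityMeasure
  have h0 := hpl.mem_Ioc
  have hkey : ∀ g : ℝ →ᵇ ℝ, (∀ x y z, (x, y, z) ∈ contactSet F pl → 0 ≤ g x + g y + g z) →
      0 ≤ ∫ x, g x ∂F := by
    intro g hg
    rw [hF.integral_eq_intervalIntegral_invCdf g.continuous]
    have hint : ∀ p q, 0 ≤ p → p ≤ q → q ≤ 1 →
        IntervalIntegrable (fun p => g (invCdf F p)) volume p q := fun p q hp hpq hq =>
      (g.continuous.comp_continuousOn (hF.continuousOn_invCdf.mono
        (Icc_subset_Icc hp hq))).intervalIntegrable_of_Icc hpq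
    rw [← intervalIntegral.integral_add_adjacent_intervals
      (hint 0 pl le_rfl h0.1.le (by linarith [h0.2]))
      (hint pl 1 h0.1.le (by linarith [h0.2]) le_rfl),
      ← intervalIntegral.integral_add_adjacent_intervals
      (hint pl (1 - 2 * pl) h0.1.le (by linarith [h0.2]) (by linarith [h0.1]))
      (hint (1 - 2 * pl) 1 (by linarith [h0.2]) (by linarith [h0.1]) le_rfl)]
    have hmid := hF.integral_middle_nonneg hpl hA g.continuous hg
    have hsubst := intervalIntegral.integral_comp_sub_mul (fun p => g (invCdf F p))
      (a := 0) (b := pl) (c := 2) two_ne_zero 1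
    rw [mul_zero, sub_zero, smul_eq_mul] at hsubst
    have hint2 : IntervalIntegrable (fun q => g (invCdf F (1 - 2 * q))) volume 0 pl :=
      (g.continuous.comp_continuousOn (hF.continuousOn_invCdf_one_sub.mono
        (Icc_subset_Icc_right h0.2))).intervalIntegrable_of_Icc h0.1.le
    have htail : 0 ≤ ∫ q in (0 : ℝ)..pl,
        (g (invCdf F q) + 2 * g (invCdf F (1 - 2 * q))) := by
      refine intervalIntegral.integral_nonneg h0.1.le fun q hq => ?_
      have m1 := hF.invCdf_mem (p := q) ⟨hq.1, by linarith [hq.2, h0.2]⟩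
      have m2 := hF.invCdf_mem (p := 1 - 2 * q) ⟨by linarith [hq.2, h0.2], by linarith [hq.1]⟩
      have := hg (invCdf F q) (invCdf F (1 - 2 * q)) (invCdf F (1 - 2 * q))
        ⟨⟨m1, m2, m2⟩, hF.reducedLoss_tail hpl hq⟩
      linarith
    rw [intervalIntegral.integral_add (hint 0 pl le_rfl h0.1.le (by linarith [h0.2]))
      (hint2.const_mul 2), intervalIntegral.integral_const_mul, hsubst] at htail
    linarith
  obtain ⟨π, h1, h2, h3, h4, h5⟩ := exists_coupling_of_forall_integral_nonneg
    (hF.isCompact_contactSet hpl)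
    (fun x y z h => ⟨⟨h.1.2.1, h.1.2.2, h.1.1⟩, by
      have := h.2
      simp only [mem_ofPred_eq] at this ⊢
      rw [← reducedLoss_rotate, this]⟩) F hkey
  exact ⟨π, ⟨h1, h3, h4, h5⟩, h2⟩

end IsTypeDistribution

end TeamSorting

/-! ### Duality and complementary slackness -/

namespace TeamSorting

open Filter Topology

/-- The surplus that a pair of wages and firm values leaves to a triple, with the opposite sign. -/
def dualSlack (w v : ℝ → ℝ) (t : ℝ × ℝ × ℝ) : ℝ :=
  w t.1 + w t.2.1 + v t.2.2 - output t.1 t.2.1 t.2.2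

lemma continuous_output : Continuous fun t : ℝ × ℝ × ℝ => output t.1 t.2.1 t.2.2 := by
  unfold output; fun_prop

/-- The optimal wages, up to the choice of additive constants. -/
noncomputable def optimalWage (F : Measure ℝ) (pl x : ℝ) : ℝ :=
  -lossPotential F pl x - minLoss F pl / 3

/-- The optimal firm values: the marginal product of a firm exceeds that of a worker of the same
type by one. -/
noncomputable def optimalValue (F : Measure ℝ) (pl z : ℝ) : ℝ := z + optimalWage F pl z

lemma dualSlack_optimal (F : Measure ℝ) (pl : ℝ) (t : ℝ × ℝ × ℝ) :
    dualSlack (optimalWage F pl) (optimalValue F pl) t =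
      reducedLoss F pl t.1 t.2.1 t.2.2 - minLoss F pl := by
  simp only [dualSlack, optimalWage, optimalValue, reducedLoss, output]
  ring

/-- A supremum of functions with a common Lipschitz constant is continuous where it is finite. -/
lemma exists_continuousOn_iSup {ι : Type*} [Nonempty ι] (c : ι → ℝ → ℝ) (b : ℝ → ℝ)
    (hlip : ∀ i, ∀ x ∈ Icc (0 : ℝ) 1, ∀ y ∈ Icc (0 : ℝ) 1, c i x ≤ c i y + |x - y|)
    (hb : ∀ i, ∀ x ∈ Icc (0 : ℝ) 1, c i x ≤ b x) :
    ∃ k : ℝ → ℝ, ContinuousOn k (Icc 0 1) ∧ (∀ i, ∀ x ∈ Icc (0 : ℝ) 1, c i x ≤ k x) ∧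
      ∀ x ∈ Icc (0 : ℝ) 1, k x ≤ b x := by
  have hle : ∀ i, ∀ x ∈ Icc (0 : ℝ) 1, c i x ≤ ⨆ i, c i x := fun i x hx =>
    le_ciSup (f := fun i => c i x) ⟨b x, by rintro _ ⟨j, rfl⟩; exact hb j x hx⟩ i
  refine ⟨fun x => ⨆ i, c i x, ?_, hle, fun x hx => ciSup_le fun i => hb i x hx⟩
  have h1 : ∀ x ∈ Icc (0 : ℝ) 1, ∀ y ∈ Icc (0 : ℝ) 1, ⨆ i, c i x ≤ (⨆ i, c i y) + |x - y| :=
    fun x hx y hy => ciSup_le fun i => (hlip i x hx y hy).trans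
      (by linarith [hle i y hy])
  refine (LipschitzOnWith.of_dist_le_mul (K := 1) fun x hx y hy => ?_).continuousOn
  rw [NNReal.coe_one, one_mul, Real.dist_eq, Real.dist_eq, abs_le]
  have h2 := h1 x hx y hy
  have h3 := h1 y hy x hx
  rw [abs_sub_comm] at h3
  constructor <;> linarith

/-- A function with a continuous subgradient is continuously differentiable. -/
lemma contDiffOn_of_subgradient {w m : ℝ → ℝ} (hm : ContinuousOn m (Icc 0 1))
    (h : ∀ x ∈ Icc (0 : ℝ) 1, ∀ y ∈ Icc (0 : ℝ) 1, m x * (y - x) ≤ w y - w x) :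
    ContDiffOn ℝ 1 w (Icc 0 1) ∧
      ∀ x ∈ Icc (0 : ℝ) 1, HasDerivWithinAt w (m x) (Icc 0 1) x := by
  have hder : ∀ x ∈ Icc (0 : ℝ) 1, HasDerivWithinAt w (m x) (Icc 0 1) x := by
    intro x hx
    rw [hasDerivWithinAt_iff_isLittleO, Asymptotics.isLittleO_iff]
    intro ε hε
    have h1 := Metric.continuousWithinAt_iff'.1 (hm x hx) ε hε
    filter_upwards [h1, self_mem_nhdsWithin] with y hy hyI
    rw [Real.dist_eq] at hy
    have h2 := h x hx y hyI
    have h3 := h y hyI x hx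
    rw [smul_eq_mul, Real.norm_eq_abs, Real.norm_eq_abs, abs_of_nonneg (by linarith)]
    calc w y - w x - (y - x) * m x ≤ (m y - m x) * (y - x) := by linarith
      _ ≤ |(m y - m x) * (y - x)| := le_abs_self _
      _ = |m y - m x| * |y - x| := abs_mul _ _
      _ ≤ ε * |y - x| := mul_le_mul_of_nonneg_right hy.le (abs_nonneg _)
  refine ⟨?_, hder⟩
  have hu : UniqueDiffOn ℝ (Icc (0 : ℝ) 1) := uniqueDiffOn_Icc zero_lt_one
  rw [show (1 : WithTop ℕ∞) = 0 + 1 by rw [zero_add], contDiffOn_succ_iff_derivWithin hu]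
  refine ⟨fun x hx => (hder x hx).differentiableWithinAt, by simp, ?_⟩
  rw [contDiffOn_zero]
  exact hm.congr fun x hx => (hder x hx).derivWithin (hu x hx)

section Duality

variable {F : Measure ℝ} {f : ℝ → ℝ} {pl : ℝ} {w v : ℝ → ℝ} {π : Measure (ℝ × ℝ × ℝ)}

lemma IsAssignment.ae_fst (hπ : IsAssignment F F π) {P : ℝ → Prop} (h : ∀ᵐ x ∂F, P x) :
    ∀ᵐ t ∂π, P t.1 :=
  ae_of_ae_map (by fun_prop) (hπ.map_worker.symm ▸ h)

lemma IsAssignment.ae_snd (hπ : IsAssignment F F π) {P : ℝ → Prop} (h : ∀ᵐ x ∂F, P x) :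
    ∀ᵐ t ∂π, P t.2.1 :=
  ae_of_ae_map (by fun_prop) (hπ.map_coworker.symm ▸ h)

lemma IsAssignment.ae_trd (hπ : IsAssignment F F π) {P : ℝ → Prop} (h : ∀ᵐ x ∂F, P x) :
    ∀ᵐ t ∂π, P t.2.2 :=
  ae_of_ae_map (by fun_prop) (hπ.map_firm.symm ▸ h)

namespace IsTypeDistribution

lemma integrable_of_continuousOn (hF : IsTypeDistribution F f) {g : ℝ → ℝ}
    (hg : ContinuousOn g (Icc 0 1)) : Integrable g F := by
  have := hF.isProbabilityMeasure
  rw [← Measure.restrict_eq_self_of_ae_mem hF.ae_mem_Icc]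
  exact hg.integrableOn_compact isCompact_Icc

lemma integrable_output (hF : IsTypeDistribution F f) (hπ : IsAssignment F F π) :
    Integrable (fun t : ℝ × ℝ × ℝ => output t.1 t.2.1 t.2.2) π := by
  have := hπ.isProbabilityMeasure
  refine Integrable.of_bound continuous_output.aestronglyMeasurable 1 ?_
  filter_upwards [hπ.ae_fst hF.ae_mem_Icc, hπ.ae_snd hF.ae_mem_Icc, hπ.ae_trd hF.ae_mem_Icc]
    with t h1 h2 h3
  have h4 : 0 ≤ t.1 * t.2.1 := mul_nonneg h1.1 h2.1
  have h5 : t.1 * t.2.1 ≤ 1 := mul_le_one₀ h1.2 h2.1 h2.2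
  rw [Real.norm_eq_abs, output, abs_of_nonneg (mul_nonneg h3.1 (by linarith))]
  exact mul_le_one₀ h3.2 (by linarith) (by linarith)

lemma integral_dualSlack (hF : IsTypeDistribution F f) (hw : Integrable w F)
    (hv : Integrable v F) (hπ : IsAssignment F F π) : Integrable (dualSlack w v) π ∧
      ∫ t, dualSlack w v t ∂π =
        dualValue F F w v - ∫ t, output t.1 t.2.1 t.2.2 ∂π := by
  have m1 : Measurable fun t : ℝ × ℝ × ℝ => t.1 := by fun_prop
  have m2 : Measurable fun t : ℝ × ℝ × ℝ => t.2.1 := by fun_prop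
  have m3 : Measurable fun t : ℝ × ℝ × ℝ => t.2.2 := by fun_prop
  have w1 : Integrable w (π.map fun t => t.1) := by rwa [hπ.map_worker]
  have w2 : Integrable w (π.map fun t => t.2.1) := by rwa [hπ.map_coworker]
  have v3 : Integrable v (π.map fun t => t.2.2) := by rwa [hπ.map_firm]
  have e1 := integral_map m1.aemeasurable w1.aestronglyMeasurable
  have e2 := integral_map m2.aemeasurable w2.aestronglyMeasurable
  have e3 := integral_map m3.aemeasurable v3.aestronglyMeasurable
  rw [hπ.map_worker] at e1
  rw [hπ.map_coworker] at e2
  rw [hπ.map_firm] at e3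
  have i1 : Integrable (fun t : ℝ × ℝ × ℝ => w t.1) π := w1.comp_measurable m1
  have i2 : Integrable (fun t : ℝ × ℝ × ℝ => w t.2.1) π := w2.comp_measurable m2
  have i3 : Integrable (fun t : ℝ × ℝ × ℝ => v t.2.2) π := v3.comp_measurable m3
  have i12 : Integrable (fun t : ℝ × ℝ × ℝ => w t.1 + w t.2.1) π := i1.add i2
  have i123 : Integrable (fun t : ℝ × ℝ × ℝ => w t.1 + w t.2.1 + v t.2.2) π := i12.add i3
  have i4 := hF.integrable_output hπ
  refine ⟨i123.sub i4, ?_⟩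
  unfold dualSlack dualValue
  rw [integral_sub i123 i4, integral_add i12 i3, integral_add i1 i2]
  linarith

lemma ae_dualSlack_nonneg (hF : IsTypeDistribution F f) (hwv : IsDualFeasible F F w v)
    (hπ : IsAssignment F F π) : ∀ᵐ t ∂π, 0 ≤ dualSlack w v t := by
  filter_upwards [hπ.ae_fst hF.ae_mem_Icc, hπ.ae_snd hF.ae_mem_Icc, hπ.ae_trd hF.ae_mem_Icc]
    with t h1 h2 h3
  have := hwv.surplus_nonpos _ h1 _ h2 _ h3
  unfold dualSlack
  linarith

lemma integral_output_le_dualValue (hF : IsTypeDistribution F f) (hwv : IsDualFeasible F F w v)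
    (hπ : IsAssignment F F π) : ∫ t, output t.1 t.2.1 t.2.2 ∂π ≤ dualValue F F w v := by
  have h1 := (hF.integral_dualSlack hwv.integrable_wage hwv.integrable_value hπ).2
  have h2 := integral_nonneg_of_ae (hF.ae_dualSlack_nonneg hwv hπ)
  linarith

lemma ae_dualSlack_eq_zero (hF : IsTypeDistribution F f) (hwv : IsDualFeasible F F w v)
    (hπ : IsAssignment F F π)
    (h : dualValue F F w v = ∫ t, output t.1 t.2.1 t.2.2 ∂π) :
    ∀ᵐ t ∂π, dualSlack w v t = 0 := by
  obtain ⟨h1, h2⟩ := hF.integral_dualSlack hwv.integrable_wage hwv.integrable_value hπ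
  rw [h, sub_self] at h2
  exact (integral_eq_zero_iff_of_nonneg_ae (hF.ae_dualSlack_nonneg hwv hπ) h1).1 h2

lemma continuous_optimalWage (hF : IsTypeDistribution F f) (hpl : IsLowerBound F pl) :
    Continuous (optimalWage F pl) := by
  have := hF.continuous_lossPotential hpl
  unfold optimalWage
  fun_prop

lemma continuous_optimalValue (hF : IsTypeDistribution F f) (hpl : IsLowerBound F pl) :
    Continuous (optimalValue F pl) :=
  continuous_id.add (hF.continuous_optimalWage hpl)

lemma isDualFeasible_optimal (hF : IsTypeDistribution F f) (hpl : IsLowerBound F pl)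
    (hA : DistributionAssumption F f pl) :
    IsDualFeasible F F (optimalWage F pl) (optimalValue F pl) where
  integrable_wage := hF.integrable_of_continuousOn (hF.continuous_optimalWage hpl).continuousOn
  integrable_value := hF.integrable_of_continuousOn (hF.continuous_optimalValue hpl).continuousOn
  surplus_nonpos x hx y hy z hz := by
    have h1 := dualSlack_optimal F pl (x, y, z)
    have h2 := hF.minLoss_le_reducedLoss hpl hA.concaveOn hx hy hz
    simp only [dualSlack] at h1
    linarith

/-- The explicit wages and firm values and an assignment on the minimisers of the reduced loss have
the same value. By weak duality both are optimal. -/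
lemma exists_optimal_pair (hF : IsTypeDistribution F f) (hpl : IsLowerBound F pl)
    (hA : DistributionAssumption F f pl) :
    IsDualSolution F F (optimalWage F pl) (optimalValue F pl) ∧ ∃ π, IsPlanningSolution F F π ∧
      dualValue F F (optimalWage F pl) (optimalValue F pl) =
        ∫ t, output t.1 t.2.1 t.2.2 ∂π := by
  obtain ⟨π, hπ, hcontact⟩ := hF.exists_assignment_contactSet hpl hA
  have hfeas := hF.isDualFeasible_optimal hpl hA
  have hval : dualValue F F (optimalWage F pl) (optimalValue F pl) =
      ∫ t, output t.1 t.2.1 t.2.2 ∂π := by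
    have h1 := (hF.integral_dualSlack hfeas.integrable_wage hfeas.integrable_value hπ).2
    have h2 : ∫ t, dualSlack (optimalWage F pl) (optimalValue F pl) t ∂π = 0 := by
      refine integral_eq_zero_of_ae ?_
      filter_upwards [hcontact] with t ht
      rw [dualSlack_optimal, Pi.zero_apply, sub_eq_zero]
      exact ht.2
    linarith
  refine ⟨⟨hfeas, fun w' v' h => ?_⟩, π, ⟨hπ, fun π' h => ?_⟩, hval⟩
  · rw [hval]; exact hF.integral_output_le_dualValue h hπ
  · rw [← hval]; exact hF.integral_output_le_dualValue hfeas h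

lemma dualValue_eq_integral_output (hF : IsTypeDistribution F f) (hpl : IsLowerBound F pl)
    (hA : DistributionAssumption F f pl) (hwv : IsDualSolution F F w v)
    (hπ : IsPlanningSolution F F π) :
    dualValue F F w v = ∫ t, output t.1 t.2.1 t.2.2 ∂π := by
  obtain ⟨h1, π₀, h2, h3⟩ := hF.exists_optimal_pair hpl hA
  refine le_antisymm ?_ (hF.integral_output_le_dualValue hwv.1 hπ.1)
  exact ((hwv.2 _ _ h1.1).trans_eq h3).trans (hπ.2 _ h2.1)

/-- Under an optimal assignment the loss of the partners is the marginal loss of every member of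
the team, by complementary slackness and the first-order conditions. -/
lemma ae_marginalProduct_eq (hF : IsTypeDistribution F f) (hpl : IsLowerBound F pl)
    (hA : DistributionAssumption F f pl) (hπ : IsPlanningSolution F F π) :
    ∀ᵐ t ∂π, marginalProduct F pl t.1 = -(t.2.1 * t.2.2) ∧
      marginalProduct F pl t.2.1 = -(t.1 * t.2.2) ∧
      marginalProduct F pl t.2.2 = -(t.1 * t.2.1) := by
  obtain ⟨h1, -⟩ := hF.exists_optimal_pair hpl hA
  have h2 := hF.ae_dualSlack_eq_zero h1.1 hπ.1 (hF.dualValue_eq_integral_output hpl hA h1 hπ)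
  filter_upwards [h2, hπ.1.ae_fst hF.ae_mem_Ioo, hπ.1.ae_snd hF.ae_mem_Ioo,
    hπ.1.ae_trd hF.ae_mem_Ioo] with ⟨x, y, z⟩ h hx hy hz
  rw [dualSlack_optimal, sub_eq_zero] at h
  simp only at h hx hy hz ⊢
  have hx' := Ioo_subset_Icc_self hx
  have hy' := Ioo_subset_Icc_self hy
  have hz' := Ioo_subset_Icc_self hz
  have e1 := hF.mul_eq_marginalLoss hpl (x := x) (y := y) (z := z) hx fun x' h' => by
    rw [h]; exact hF.minLoss_le_reducedLoss hpl hA.concaveOn h' hy' hz'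
  have e2 := hF.mul_eq_marginalLoss hpl (x := y) (y := x) (z := z) hy fun x' h' => by
    rw [reducedLoss_swap, h]; exact hF.minLoss_le_reducedLoss hpl hA.concaveOn h' hx' hz'
  have e3 := hF.mul_eq_marginalLoss hpl (x := z) (y := x) (z := y) hz fun x' h' => by
    rw [reducedLoss_rotate, h]; exact hF.minLoss_le_reducedLoss hpl hA.concaveOn h' hx' hy'
  rw [marginalLoss_of_mem F pl hx'] at e1
  rw [marginalLoss_of_mem F pl hy'] at e2
  rw [marginalLoss_of_mem F pl hz'] at e3
  exact ⟨by linarith, by linarith, by linarith⟩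

/-! ### Regularity of dual solutions -/

/-- Every dual solution is almost everywhere equal to a continuous one. First the wages are
replaced by the smallest that a coworker and a firm leave to a worker: since the average of the
old and the new wages is feasible, the change is null, and by density the new wages are feasible
against themselves. The firm values are replaced likewise. -/
lemma exists_continuous_dualSolution (hF : IsTypeDistribution F f)
    (hwv : IsDualSolution F F w v) :
    ∃ w' v' : ℝ → ℝ, IsDualSolution F F w' v' ∧ ContinuousOn w' (Icc 0 1) ∧
      ContinuousOn v' (Icc 0 1) ∧ w' =ᵐ[F] w ∧ v' =ᵐ[F] v := by
  have hne : Nonempty (Icc (0 : ℝ) 1 × Icc (0 : ℝ) 1) := ⟨⟨0, by simp⟩, ⟨0, by simp⟩⟩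
  have hfeas := hwv.1.surplus_nonpos
  obtain ⟨k, hkc, hk1, hk2⟩ := exists_continuousOn_iSup
    (fun (i : Icc (0 : ℝ) 1 × Icc (0 : ℝ) 1) x => output x i.1 i.2 - w i.1 - v i.2) w
    (by
      rintro ⟨⟨y, hy⟩, ⟨z, hz⟩⟩ x hx x' hx'
      have h1 : |(x - x') * (y * z)| ≤ |x - x'| * 1 := by
        rw [abs_mul]
        refine mul_le_mul_of_nonneg_left ?_ (abs_nonneg _)
        rw [abs_of_nonneg (mul_nonneg hy.1 hz.1)]
        exact mul_le_one₀ hy.2 hz.1 hz.2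
      have h2 := (abs_le.1 h1).1
      simp only [output]
      linarith)
    (by
      rintro ⟨⟨y, hy⟩, ⟨z, hz⟩⟩ x hx
      have := hfeas x hx y hy z hz
      simp only
      linarith)
  have hki := hF.integrable_of_continuousOn hkc
  have hkw : ∀ᵐ x ∂F, k x ≤ w x := by
    filter_upwards [hF.ae_mem_Icc] with x hx using hk2 x hx
  have hk1' : ∀ x ∈ Icc (0 : ℝ) 1, ∀ y ∈ Icc (0 : ℝ) 1, ∀ z ∈ Icc (0 : ℝ) 1,
      output x y z ≤ k x + w y + v z := by
    intro x hx y hy z hz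
    have h1 : output x y z - w y - v z ≤ k x := hk1 ⟨⟨y, hy⟩, ⟨z, hz⟩⟩ x hx
    linarith
  have hhalf : IsDualFeasible F F (fun x => (w x + k x) / 2) v := by
    refine ⟨(hwv.1.integrable_wage.add hki).div_const 2, hwv.1.integrable_value, ?_⟩
    intro x hx y hy z hz
    have h1 := hk1' x hx y hy z hz
    have h2 := hk1' y hy x hx z hz
    have h3 : output y x z = output x y z := by simp only [output]; ring
    linarith
  have hkae : k =ᵐ[F] w := by
    rw [← integral_eq_iff_of_ae_le hki hwv.1.integrable_wage hkw]
    refine le_antisymm (integral_mono_ae hki hwv.1.integrable_wage hkw) ?_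
    have h1 := hwv.2 _ _ hhalf
    unfold dualValue at h1
    rw [integral_div, integral_add hwv.1.integrable_wage hki] at h1
    linarith
  have hkk : ∀ x ∈ Icc (0 : ℝ) 1, ∀ y ∈ Icc (0 : ℝ) 1, ∀ z ∈ Icc (0 : ℝ) 1,
      output x y z ≤ k x + k y + v z := by
    intro x hx y hy z hz
    have h1 := hF.subset_closure_of_ae hkae hy
    have hsub : {y | y ∈ Icc (0 : ℝ) 1 ∧ k y = w y} ⊆ Icc 0 1 := fun _ h => h.1
    refine ContinuousWithinAt.closure_le (f := fun y => output x y z)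
      (g := fun y => k x + k y + v z) h1 ?_ ?_ ?_
    · exact Continuous.continuousWithinAt (by unfold output; fun_prop)
    · exact (continuousWithinAt_const.add ((hkc y hy).mono hsub)).add continuousWithinAt_const
    · intro y' hy'
      have := hk1' x hx y' hy'.1 z hz
      rw [← hy'.2] at this
      exact this
  obtain ⟨l, hlc, hl1, hl2⟩ := exists_continuousOn_iSup
    (fun (i : Icc (0 : ℝ) 1 × Icc (0 : ℝ) 1) z => output i.1 i.2 z - k i.1 - k i.2) v
    (by
      rintro ⟨⟨x, hx⟩, ⟨y, hy⟩⟩ z hz z' hz'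
      have h0 : 0 ≤ x * y := mul_nonneg hx.1 hy.1
      have h1 : |(z - z') * (1 - x * y)| ≤ |z - z'| * 1 := by
        rw [abs_mul]
        refine mul_le_mul_of_nonneg_left ?_ (abs_nonneg _)
        rw [abs_of_nonneg (by linarith [mul_le_one₀ hx.2 hy.1 hy.2])]
        linarith
      have h2 := (abs_le.1 h1).2
      simp only [output]
      linarith)
    (by
      rintro ⟨⟨x, hx⟩, ⟨y, hy⟩⟩ z hz
      have := hkk x hx y hy z hz
      simp only
      linarith)
  have hli := hF.integrable_of_continuousOn hlc
  have hlv : ∀ᵐ z ∂F, l z ≤ v z := by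
    filter_upwards [hF.ae_mem_Icc] with z hz using hl2 z hz
  have hkl : IsDualFeasible F F k l := by
    refine ⟨hki, hli, fun x hx y hy z hz => ?_⟩
    have h1 : output x y z - k x - k y ≤ l z := hl1 ⟨⟨x, hx⟩, ⟨y, hy⟩⟩ z hz
    linarith
  have hkint : ∫ x, k x ∂F = ∫ x, w x ∂F := integral_congr_ae hkae
  have hlint : ∫ z, l z ∂F = ∫ z, v z ∂F := by
    refine le_antisymm (integral_mono_ae hli hwv.1.integrable_value hlv) ?_
    have h1 := hwv.2 _ _ hkl
    unfold dualValue at h1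
    rw [hkint] at h1
    linarith
  refine ⟨k, l, ⟨hkl, fun w' v' h => ?_⟩, hkc, hlc, hkae,
    (integral_eq_iff_of_ae_le hli hwv.1.integrable_value hlv).1 hlint⟩
  have h1 := hwv.2 w' v' h
  unfold dualValue at h1 ⊢
  rwa [hkint, hlint]

/-- Every type has, among the triples without slack, one whose partners generate its marginal
product. Such triples fill a compact set of full measure, whose projections are all of `[0,1]`. -/
lemma exists_tight_triple (hF : IsTypeDistribution F f) (hpl : IsLowerBound F pl)
    (hA : DistributionAssumption F f pl) (hwv : IsDualSolution F F w v)
    (hw : ContinuousOn w (Icc 0 1)) (hv : ContinuousOn v (Icc 0 1)) :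
    (∀ x ∈ Icc (0 : ℝ) 1, ∃ y ∈ Icc (0 : ℝ) 1, ∃ z ∈ Icc (0 : ℝ) 1,
      dualSlack w v (x, y, z) = 0 ∧ marginalProduct F pl x = -(y * z)) ∧
    ∀ z ∈ Icc (0 : ℝ) 1, ∃ x ∈ Icc (0 : ℝ) 1, ∃ y ∈ Icc (0 : ℝ) 1,
      dualSlack w v (x, y, z) = 0 ∧ marginalProduct F pl z = -(x * y) := by
  obtain ⟨-, π, hπ, -⟩ := hF.exists_optimal_pair hpl hA
  have hm := hF.continuousOn_marginalProduct hpl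
  set Q : Set (ℝ × ℝ × ℝ) := Icc (0 : ℝ) 1 ×ˢ Icc (0 : ℝ) 1 ×ˢ Icc (0 : ℝ) 1 with hQ
  have hQc : IsCompact Q := isCompact_Icc.prod (isCompact_Icc.prod isCompact_Icc)
  have c1 : ∀ {g : ℝ → ℝ}, ContinuousOn g (Icc 0 1) →
      ContinuousOn (fun t : ℝ × ℝ × ℝ => g t.1) Q := fun hg =>
    hg.comp (by fun_prop) fun t ht => ht.1
  have c2 : ∀ {g : ℝ → ℝ}, ContinuousOn g (Icc 0 1) →
      ContinuousOn (fun t : ℝ × ℝ × ℝ => g t.2.1) Q := fun hg =>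
    hg.comp (by fun_prop) fun t ht => ht.2.1
  have c3 : ∀ {g : ℝ → ℝ}, ContinuousOn g (Icc 0 1) →
      ContinuousOn (fun t : ℝ × ℝ × ℝ => g t.2.2) Q := fun hg =>
    hg.comp (by fun_prop) fun t ht => ht.2.2
  set T : Set (ℝ × ℝ × ℝ) := Q ∩ (fun t => (dualSlack w v t,
    marginalProduct F pl t.1 + t.2.1 * t.2.2, marginalProduct F pl t.2.2 + t.1 * t.2.1)) ⁻¹'
      {(0 : ℝ × ℝ × ℝ)} with hT
  have hTc : IsCompact T := by
    refine hQc.of_isClosed_subset ?_ inter_subset_left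
    refine ContinuousOn.preimage_isClosed_of_isClosed ?_ hQc.isClosed isClosed_singleton
    refine ContinuousOn.prodMk ?_ (ContinuousOn.prodMk ?_ ?_)
    · exact (((c1 hw).add (c2 hw)).add (c3 hv)).sub continuous_output.continuousOn
    · exact (c1 hm).add (by fun_prop)
    · exact (c3 hm).add (by fun_prop)
  have hae : ∀ᵐ t ∂π, t ∈ T := by
    filter_upwards [hπ.1.ae_fst hF.ae_mem_Icc, hπ.1.ae_snd hF.ae_mem_Icc,
      hπ.1.ae_trd hF.ae_mem_Icc, hF.ae_marginalProduct_eq hpl hA hπ,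
      hF.ae_dualSlack_eq_zero hwv.1 hπ.1 (hF.dualValue_eq_integral_output hpl hA hwv hπ)]
      with t h1 h2 h3 h4 h5
    refine ⟨⟨h1, h2, h3⟩, ?_⟩
    simp [h5, h4.1, h4.2.2]
  have hmem : ∀ t ∈ T, dualSlack w v t = 0 ∧ marginalProduct F pl t.1 = -(t.2.1 * t.2.2) ∧
      marginalProduct F pl t.2.2 = -(t.1 * t.2.1) := by
    intro t ht
    have h1 := ht.2
    simp only [mem_preimage, mem_singleton_iff, Prod.ext_iff, Prod.fst_zero, Prod.snd_zero] at h1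
    exact ⟨h1.1, by linarith [h1.2.1], by linarith [h1.2.2]⟩
  have hproj : ∀ c : ℝ × ℝ × ℝ → ℝ, Continuous c → π.map c = F → Icc (0 : ℝ) 1 ⊆ c '' T := by
    intro c hc hmap
    have hcl : IsClosed (c '' T) := (hTc.image hc).isClosed
    have h1 : ∀ᵐ x ∂F, x ∈ c '' T := by
      rw [← hmap]
      refine (ae_map_iff (p := fun x => x ∈ c '' T) hc.measurable.aemeasurable
        hcl.measurableSet).2 ?_
      filter_upwards [hae] with t ht using mem_image_of_mem c ht
    refine (hF.subset_closure_of_ae h1).trans ?_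
    exact closure_minimal (fun x hx => hx.2) hcl
  constructor
  · intro x hx
    obtain ⟨⟨x', y, z⟩, ht, rfl⟩ := hproj (fun t => t.1) (by fun_prop) hπ.1.map_worker hx
    have h1 := hmem _ ht
    exact ⟨y, ht.1.2.1, z, ht.1.2.2, h1.1, h1.2.1⟩
  · intro z hz
    obtain ⟨⟨x, y, z'⟩, ht, rfl⟩ := hproj (fun t => t.2.2) (by fun_prop) hπ.1.map_firm hz
    have h1 := hmem _ ht
    exact ⟨x, ht.1.1, y, ht.1.2.1, h1.1, h1.2.2⟩

/-- The partners in tight triples provide subgradients: `m` for the wages, and `m + 1` for the firm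
values, of a continuous dual solution. -/
lemma contDiffOn_dualSolution (hF : IsTypeDistribution F f) (hpl : IsLowerBound F pl)
    (hA : DistributionAssumption F f pl) (hwv : IsDualSolution F F w v)
    (hw : ContinuousOn w (Icc 0 1)) (hv : ContinuousOn v (Icc 0 1)) :
    (ContDiffOn ℝ 1 w (Icc 0 1) ∧
      ∀ x ∈ Icc (0 : ℝ) 1, HasDerivWithinAt w (marginalProduct F pl x) (Icc 0 1) x) ∧
    (ContDiffOn ℝ 1 v (Icc 0 1) ∧
      ∀ z ∈ Icc (0 : ℝ) 1, HasDerivWithinAt v (marginalProduct F pl z + 1) (Icc 0 1) z) := by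
  have hm := hF.continuousOn_marginalProduct hpl
  obtain ⟨h1, h2⟩ := hF.exists_tight_triple hpl hA hwv hw hv
  constructor
  · refine contDiffOn_of_subgradient hm fun x hx x' hx' => ?_
    obtain ⟨y, hy, z, hz, h3, h4⟩ := h1 x hx
    have h5 := hwv.1.surplus_nonpos x' hx' y hy z hz
    simp only [dualSlack, output] at h3 h5
    rw [h4]
    linarith
  · refine contDiffOn_of_subgradient (hm.add continuousOn_const) fun z hz z' hz' => ?_
    obtain ⟨x, hx, y, hy, h3, h4⟩ := h2 z hz
    have h5 := hwv.1.surplus_nonpos x hx y hy z' hz'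
    simp only [dualSlack, output] at h3 h5
    rw [h4]
    linarith

end IsTypeDistribution

end Duality

end TeamSorting

theorem mainTheorem5 (F : MeasureTheory.Measure ℝ) (f : ℝ → ℝ) (pl : ℝ)
    (hF : TeamSorting.IsTypeDistribution F f)
    (hpl : TeamSorting.IsLowerBound F pl)
    (hA : TeamSorting.DistributionAssumption F f pl) :
    -- the dual problem has a continuous solution
    (∃ w v : ℝ → ℝ, TeamSorting.IsDualSolution F F w v ∧
      ContinuousOn w (Icc 0 1) ∧ ContinuousOn v (Icc 0 1)) ∧
    -- every dual solution agrees almost everywhere with a continuous one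
    (∀ w v : ℝ → ℝ, TeamSorting.IsDualSolution F F w v →
      ∃ w' v' : ℝ → ℝ, TeamSorting.IsDualSolution F F w' v' ∧
        ContinuousOn w' (Icc 0 1) ∧ ContinuousOn v' (Icc 0 1) ∧ w' =ᵐ[F] w ∧ v' =ᵐ[F] v) ∧
    -- continuous dual solutions are continuously differentiable, with the stated derivatives
    (∀ w v : ℝ → ℝ, TeamSorting.IsDualSolution F F w v →
      ContinuousOn w (Icc 0 1) → ContinuousOn v (Icc 0 1) →
        ContDiffOn ℝ 1 w (Icc 0 1) ∧ ContDiffOn ℝ 1 v (Icc 0 1) ∧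
        (∀ x ∈ Icc (0 : ℝ) 1,
          HasDerivWithinAt w (TeamSorting.marginalProduct F pl x) (Icc 0 1) x) ∧
        (∀ z ∈ Icc (0 : ℝ) 1,
          HasDerivWithinAt v (TeamSorting.marginalProduct F pl z + 1) (Icc 0 1) z)) ∧
    -- the function in these derivatives is the marginal product under any optimal assignment
    (∃ π, TeamSorting.IsPlanningSolution F F π) ∧
    (∀ π, TeamSorting.IsPlanningSolution F F π → ∀ᵐ t ∂π,
      TeamSorting.marginalProduct F pl t.1 = -(t.2.1 * t.2.2) ∧
      TeamSorting.marginalProduct F pl t.2.1 = -(t.1 * t.2.2) ∧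
      TeamSorting.marginalProduct F pl t.2.2 = -(t.1 * t.2.1)) := by
  refine ⟨⟨_, _, (hF.exists_optimal_pair hpl hA).1,
    (hF.continuous_optimalWage hpl).continuousOn, (hF.continuous_optimalValue hpl).continuousOn⟩,
    fun w v h => hF.exists_continuous_dualSolution h, fun w v h hw hv => ?_, ?_,
    fun π hπ => hF.ae_marginalProduct_eq hpl hA hπ⟩
  · obtain ⟨⟨h1, h2⟩, h3, h4⟩ := hF.contDiffOn_dualSolution hpl hA h hw hv
    exact ⟨h1, h3, h2, h4⟩
  · obtain ⟨-, π, hπ, -⟩ := hF.exists_optimal_pair hpl hA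
    exact ⟨π, hπ⟩
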